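/- Let $m\ge 0$, $N\ge 0$ be integers and $M=2^m$. For $0\le i\le M-1$ let $n_{i,k}$ ($k=0,\dots,m-1$) be the binary digits of $i$, so $i=\sum_k n_{i,k}2^k$ (natural binary code). Let the bits $C_0,\dots,C_{m-1}$ be independent with $0<P_{C_k}(0)<1$ and $P_{C_k}(1)=1-P_{C_k}(0)$, let $\mathbb X=[\boldsymbol x_0,\dots,\boldsymbol x_{M-1}]$ be an alphabet of vectors in $\mathbb R^N$, not all zero, and let $\boldsymbol X=\boldsymbol x_i$ be the symbol whose index $i$ has the binary digits $C_0,\dots,C_{m-1}$; index $i$ thus has probability $P_i=\prod_{k=0}^{m-1}P_{C_k}(n_{i,k})$. Consider the channel $\boldsymbol Y=\boldsymbol H\circ\boldsymbol X+\boldsymbol Z$ (element-wise product), where $\boldsymbol Z$ is Gaussian with independent components of mean $0$ and variance $N_0/2$, $N_0>0$, and $\boldsymbol H$ is a random vector in $\mathbb R^N$, known at the receiver, whose (possibly dependent) components all have the same law, with $0<\mathbb E[H^2]<\infty$; $(C_0,\dots,C_{m-1})$, $\boldsymbol H$, $\boldsymbol Z$ are independent. Put $E_{\mathrm s}=\sum_i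 P_i\|\boldsymbol x_i\|^2$, $\mathrm{SNR}=\mathbb E[H^2]E_{\mathrm s}/N_0$, and let $$I(\mathrm{SNR})=\sum_{k=0}^{m-1} I(C_k;\boldsymbol Y\,|\,\boldsymbol H)$$ (in bits) be the BICM generalized mutual information as a function of $\mathrm{SNR}\ge 0$, where $\mathrm{SNR}$ is varied by rescaling $\mathbb X$ linearly at fixed $N_0$. The constellation $[\mathbb X,\mathbb P]$, $\mathbb P=[P_0,\dots,P_{M-1}]$, is called first-order optimal if the (right) derivative $\alpha=\frac{dI}{d\,\mathrm{SNR}}\big|_{\mathrm{SNR}=0}$ equals $\log_2\mathrm e$, i.e. if the system reaches the Shannon limit $-1.59$ dB. Let $$\tilde{\boldsymbol x}_i=\frac1M\sum_{j=0}^{M-1}\boldsymbol x_j\prod_{k=0}^{m-1}(-1)^{n_{i,k}n_{j,k}}$$ be the Hadamard transform of $\mathbb X$. Theorem. $[\mathbb X,\mathbb P]$ is first-order optimal if and only if both $$\tilde{\boldsymbol x}_0=\sum_{k=0}^{m-1}\tilde{\boldsymbol x}_{2^k}\bigl(P_{C_k}(1)-P_{C_k}(0)\bigr)\qquad\text{and}\qquad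 \tilde{\boldsymbol x}_j=\boldsymbol 0\ \text{ for all } j\in\{0,\dots,M-1\}\setminus\bigl(\{0\}\cup\{1,2,4,\dots,2^{m-1}\}\bigr).$$ -/

import Mathlib

open MeasureTheory

noncomputable section

namespace BICM

/-- The probability `P_{C_k}(u)` of the value `u` of the `k`th bit, where `b k = P_{C_k}(0)`
(`false` is the bit 0, `true` is the bit 1). -/
def bitProb {m : ℕ} (b : Fin m → ℝ) (k : Fin m) (u : Bool) : ℝ :=
  if u then 1 - b k else b k

/-- The natural binary code: `nbc i k` is the `k`th bit of `i`, bit `m - 1` being the most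
significant one. -/
def nbc {m : ℕ} (i : Fin (2 ^ m)) (k : Fin m) : Bool :=
  (i : ℕ).testBit k

/-- The product-form symbol probabilities `P_i = ∏_k P_{C_k}(n_{i,k})`. -/
def symbolProb {m : ℕ} (b : Fin m → ℝ) (i : Fin (2 ^ m)) : ℝ :=
  ∏ k, bitProb b k (nbc i k)

/-- The Hadamard coefficient `h_{i,j} = ∏_k (-1)^(n_{i,k} n_{j,k})`. -/
def hadamardCoeff {m : ℕ} (i j : Fin (2 ^ m)) : ℝ :=
  ∏ k, (-1 : ℝ) ^ ((nbc i k).toNat * (nbc j k).toNat)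

/-- The Hadamard transform of an alphabet with `2 ^ m` points. -/
def hadamard {m N : ℕ} (X : Fin (2 ^ m) → EuclideanSpace ℝ (Fin N)) (i : Fin (2 ^ m)) :
    EuclideanSpace ℝ (Fin N) :=
  (1 / (2 : ℝ) ^ m) • ∑ j, hadamardCoeff i j • X j

/-- The index `2 ^ k`. -/
def powTwo {m : ℕ} (k : Fin m) : Fin (2 ^ m) :=
  ⟨2 ^ (k : ℕ), Nat.pow_lt_pow_right one_lt_two k.isLt⟩

/-- The index `0`. -/
def zeroIdx (m : ℕ) : Fin (2 ^ m) :=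
  ⟨0, Nat.two_pow_pos m⟩

/-- The element-wise product of two vectors. -/
def ewProd {N : ℕ} (h x : EuclideanSpace ℝ (Fin N)) : EuclideanSpace ℝ (Fin N) :=
  WithLp.toLp 2 (fun n => h n * x n)

/-- The conditional pdf `p_{Y|X,H}(y|x,h)` of the channel `Y = H ∘ X + Z`, where `Z` is Gaussian
with mean zero and variance `N₀ / 2` in each dimension. -/
def channelPdf {N : ℕ} (N₀ : ℝ) (h x y : EuclideanSpace ℝ (Fin N)) : ℝ :=
  1 / (N₀ * Real.pi) ^ ((N : ℝ) / 2) * Real.exp (-(‖y - ewProd h x‖ ^ 2 / N₀))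

/-- The conditional pdf `p_{Y|H}(y|h)`. -/
def outputPdf {m N : ℕ} (N₀ : ℝ) (b : Fin m → ℝ) (X : Fin (2 ^ m) → EuclideanSpace ℝ (Fin N))
    (h y : EuclideanSpace ℝ (Fin N)) : ℝ :=
  ∑ i, symbolProb b i * channelPdf N₀ h (X i) y

/-- The conditional pdf `p_{Y|H,C_k}(y|h,u)`: the symbol index is distributed according to its
conditional law given that its `k`th bit is `u`. -/
def bitOutputPdf {m N : ℕ} (N₀ : ℝ) (b : Fin m → ℝ)
    (X : Fin (2 ^ m) → EuclideanSpace ℝ (Fin N)) (k : Fin m) (u : Bool)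
    (h y : EuclideanSpace ℝ (Fin N)) : ℝ :=
  ∑ i with nbc i k = u, symbolProb b i / bitProb b k u * channelPdf N₀ h (X i) y

/-- The mutual information `I(C_k; Y | H = h)` in bits, that is, the expectation of
`log₂ (p_{Y|H,C_k}(Y|h,C_k) / p_{Y|H}(Y|h))` given `H = h`. -/
def bitMutualInfoAt {m N : ℕ} (N₀ : ℝ) (b : Fin m → ℝ)
    (X : Fin (2 ^ m) → EuclideanSpace ℝ (Fin N)) (k : Fin m) (h : EuclideanSpace ℝ (Fin N)) : ℝ :=
  ∑ u : Bool, bitProb b k u *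
    (∫ y, bitOutputPdf N₀ b X k u h y *
      Real.logb 2 (bitOutputPdf N₀ b X k u h y / outputPdf N₀ b X h y))

/-- The mutual information `I(C_k; Y | H)` in bits; `ρ` is the law of `H`, which is independent of
the transmitted bits. -/
def bitMutualInfo {m N : ℕ} (ρ : Measure (EuclideanSpace ℝ (Fin N))) (N₀ : ℝ) (b : Fin m → ℝ)
    (X : Fin (2 ^ m) → EuclideanSpace ℝ (Fin N)) (k : Fin m) : ℝ :=
  ∫ h, bitMutualInfoAt N₀ b X k h ∂ρ

/-- The BICM generalized mutual information of the constellation given by the alphabet `X` and the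
bit probabilities `b`, at noise level `N₀`. -/
def gmi {m N : ℕ} (ρ : Measure (EuclideanSpace ℝ (Fin N))) (N₀ : ℝ) (b : Fin m → ℝ)
    (X : Fin (2 ^ m) → EuclideanSpace ℝ (Fin N)) : ℝ :=
  ∑ k, bitMutualInfo ρ N₀ b X k

/-- The average symbol energy `E_s = E[‖X‖²]`. -/
def symbolEnergy {m N : ℕ} (b : Fin m → ℝ) (X : Fin (2 ^ m) → EuclideanSpace ℝ (Fin N)) : ℝ :=
  ∑ i, symbolProb b i * ‖X i‖ ^ 2

/-- The signal-to-noise ratio `E[H²] E_s / N₀`; `ν` is the common law of the fading coefficients. -/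
def snr {m N : ℕ} (ν : Measure ℝ) (N₀ : ℝ) (b : Fin m → ℝ)
    (X : Fin (2 ^ m) → EuclideanSpace ℝ (Fin N)) : ℝ :=
  (∫ t, t ^ 2 ∂ν) * (symbolEnergy b X / N₀)

/-- The alphabet `X`, rescaled so that the signal-to-noise ratio becomes `s`. -/
def rescaled {m N : ℕ} (ν : Measure ℝ) (N₀ : ℝ) (b : Fin m → ℝ)
    (X : Fin (2 ^ m) → EuclideanSpace ℝ (Fin N)) (s : ℝ) :
    Fin (2 ^ m) → EuclideanSpace ℝ (Fin N) :=
  fun i => Real.sqrt (s / snr ν N₀ b X) • X i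

theorem snr_rescaled {m N : ℕ} (ν : Measure ℝ) (N₀ : ℝ) (b : Fin m → ℝ)
    (X : Fin (2 ^ m) → EuclideanSpace ℝ (Fin N)) (s : ℝ) (hs : 0 ≤ s)
    (h : 0 < snr ν N₀ b X) : snr ν N₀ b (rescaled ν N₀ b X s) = s := by
  have key : symbolEnergy b (rescaled ν N₀ b X s)
      = s / snr ν N₀ b X * symbolEnergy b X := by
    unfold symbolEnergy
    rw [Finset.mul_sum]
    refine Finset.sum_congr rfl fun i _ => ?_
    rw [rescaled, norm_smul, mul_pow, Real.norm_eq_abs, sq_abs,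
      Real.sq_sqrt (div_nonneg hs h.le)]
    ring
  have e : snr ν N₀ b (rescaled ν N₀ b X s) = s / snr ν N₀ b X * snr ν N₀ b X := by
    conv_lhs => rw [snr, key]
    conv_rhs => rw [mul_comm, snr]
    simp only [snr]
    ring
  rw [e, div_mul_cancel₀ _ h.ne']

/-- The BICM generalized mutual information as a function of the signal-to-noise ratio `s ≥ 0`. -/
def gmiOfSNR {m N : ℕ} (ρ : Measure (EuclideanSpace ℝ (Fin N))) (ν : Measure ℝ) (N₀ : ℝ)
    (b : Fin m → ℝ) (X : Fin (2 ^ m) → EuclideanSpace ℝ (Fin N)) (s : ℝ) : ℝ :=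
  gmi ρ N₀ b (rescaled ν N₀ b X s)

/-- First-order optimality: the derivative `α` of the generalized mutual information with respect
to the signal-to-noise ratio at zero (from the right, since ratios are nonnegative) exists and
equals `log₂ e`. -/
def IsFOO {m N : ℕ} (ρ : Measure (EuclideanSpace ℝ (Fin N))) (ν : Measure ℝ) (N₀ : ℝ)
    (b : Fin m → ℝ) (X : Fin (2 ^ m) → EuclideanSpace ℝ (Fin N)) : Prop :=
  HasDerivWithinAt (gmiOfSNR ρ ν N₀ b X) (Real.logb 2 (Real.exp 1)) (Set.Ici 0) 0

end BICM

end

/-! Every mutual information is measured against the pure noise law. Writing D(w) for the relative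
entropy of the output under index law w with respect to the centred Gaussian, I(C_k;Y|H=h) is the
average of D over the two conditional laws given C_k, minus D of the full law, divided by log 2
(`sum_integral_mixtureLikelihood_mul_log_div`). For an input scaled by t, D(w) is asymptotic to t²
times the squared norm of the mean input, divided by N₀: only conditional means survive
(`tendsto_mixtureKL_smul_div_sq`). Averaging over the fading contributes the factor E[H²]. Since SNR
is proportional to t², the slope at zero is log₂ e times V/E_s, where V is the sum over k of the
variances of E[X|C_k] (`hasDerivWithinAt_gmiOfSNR`).

Centred functions of distinct independent bits are orthogonal in L², so V is the squared norm of the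
projection of X onto the space of sums ∑_k f_k(C_k) with each f_k(C_k) of mean zero. By Pythagoras V
= E_s exactly when X lies in that space (`bitwiseVariance_eq_symbolEnergy_iff`). A centred function
of one bit is a vector multiple of (-1)^u + P(1) - P(0), that is, of a Walsh function of order one
plus a prescribed constant. Inverting the Hadamard transform turns membership into the two stated
conditions (`exists_centred_iff_hadamard`). -/

noncomputable section

namespace BICM

open Filter Topology InformationTheory Real

/-! ### Second-order behaviour of x log x + 1 - x at 1 -/

section Scalar

theorem klFun_le_sq {x : ℝ} (hx : 0 < x) : klFun x ≤ (x - 1) ^ 2 := by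
  have h := mul_le_mul_of_nonneg_left (log_le_sub_one_of_pos hx) hx.le
  rw [klFun_apply]
  nlinarith

theorem abs_exp_sub_one_le_mul_exp (t : ℝ) : |exp t - 1| ≤ |t| * exp |t| := by
  have h1 := add_one_le_exp t
  have h2 := add_one_le_exp (-t)
  have h3 : 1 ≤ exp |t| := one_le_exp (abs_nonneg t)
  have h4 : exp t ≤ exp |t| := exp_le_exp.2 (le_abs_self t)
  have h5 : exp t * exp (-t) = 1 := by rw [← exp_add]; simp
  rw [abs_le]
  constructor
  · nlinarith [neg_abs_le t, abs_nonneg t]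
  · have h6 : exp t - 1 ≤ t * exp t := by nlinarith [exp_pos t]
    refine h6.trans ?_
    have := mul_le_mul_of_nonneg_right (le_abs_self t) (exp_pos t).le
    nlinarith [abs_nonneg t]

/-- L'Hôpital once: the derivatives are log x and 2(x - 1), whose quotient is half the difference
quotient of log at 1. -/
theorem tendsto_klFun_div_sq :
    Tendsto (fun x : ℝ => klFun x / (x - 1) ^ 2) (𝓝[≠] 1) (𝓝 (1 / 2)) := by
  refine HasDerivAt.lhopital_zero_nhdsNE (f' := log) (g' := fun x => 2 * (x - 1)) ?_ ?_ ?_ ?_ ?_ ?_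
  · filter_upwards [nhdsWithin_le_nhds (isOpen_ne.mem_nhds one_ne_zero)] with x hx
    exact hasDerivAt_klFun hx
  · refine Eventually.of_forall fun x => ?_
    simpa [Pi.pow_def] using ((hasDerivAt_id x).sub_const 1).pow 2
  · filter_upwards [self_mem_nhdsWithin] with x hx
    have : x - 1 ≠ 0 := sub_ne_zero.2 hx
    positivity
  · have := continuous_klFun.tendsto 1
    rw [klFun_one] at this
    exact this.mono_left nhdsWithin_le_nhds
  · have : Tendsto (fun x : ℝ => (x - 1) ^ 2) (𝓝 1) (𝓝 ((1 - 1) ^ 2)) :=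
      Continuous.tendsto (by fun_prop) 1
    simp only [sub_self, ne_eq, OfNat.ofNat_ne_zero, not_false_eq_true, zero_pow] at this
    exact this.mono_left nhdsWithin_le_nhds
  · have h := hasDerivAt_iff_tendsto_slope.1 (hasDerivAt_log (one_ne_zero (α := ℝ)))
    have h2 := h.mul_const (1 / 2 : ℝ)
    simp only [inv_one, one_mul] at h2
    refine h2.congr fun x => ?_
    rw [slope_def_field, log_one, sub_zero, div_mul_div_comm, mul_one, mul_comm (x - 1)]

/-- The second-order behaviour of `klFun` along a differentiable curve through `1`. -/
theorem tendsto_klFun_comp_div_sq {R : ℝ → ℝ} {r : ℝ} (hR : HasDerivAt R r 0) (h0 : R 0 = 1) :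
    Tendsto (fun t => klFun (R t) / t ^ 2) (𝓝[≠] 0) (𝓝 (r ^ 2 / 2)) := by
  -- The curve may return to 1 at nonzero t, where the quotient takes the default value 0/0 = 0.
  -- Assigning the limit value there makes it continuous at 1, so it can be composed with `R`; at
  -- such t the squared slope is 0 anyway.
  have hk : ContinuousAt (Function.update (fun x : ℝ => klFun x / (x - 1) ^ 2) 1 (1 / 2)) 1 :=
    continuousAt_update_same.2 tendsto_klFun_div_sq
  have h1 : Tendsto R (𝓝[≠] 0) (𝓝 1) := by
    have := hR.continuousAt.tendsto
    rw [h0] at this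
    exact this.mono_left nhdsWithin_le_nhds
  have h2 := (hk.tendsto.comp h1).mul ((hasDerivAt_iff_tendsto_slope.1 hR).pow 2)
  rw [Function.update_self] at h2
  have e : 1 / 2 * r ^ 2 = r ^ 2 / 2 := by ring
  rw [e] at h2
  refine h2.congr fun t => ?_
  rw [Function.comp_apply, slope_def_field, h0, sub_zero]
  by_cases h : R t = 1
  · simp [h, klFun_one]
  · have : R t - 1 ≠ 0 := sub_ne_zero.2 h
    rw [Function.update_of_ne h]
    field_simp

end Scalar

/-! ### Gaussian integrals and shifted likelihood ratios -/

section Gaussian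

variable {V : Type*} [NormedAddCommGroup V] [InnerProductSpace ℝ V]

/-- The density of the centred Gaussian law with variance `c / 2` in each direction. -/
def gaussDensity (c : ℝ) (v : V) : ℝ :=
  1 / (c * π) ^ ((Module.finrank ℝ V : ℝ) / 2) * exp (-(‖v‖ ^ 2 / c))

/-- The density of a shifted Gaussian law relative to the centred one. -/
def likelihood (c : ℝ) (a v : V) : ℝ :=
  exp ((2 * inner ℝ v a - ‖a‖ ^ 2) / c)

theorem gaussDensity_pos {c : ℝ} (hc : 0 < c) (v : V) : 0 < gaussDensity c v := by
  unfold gaussDensity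
  positivity

theorem likelihood_pos (c : ℝ) (a v : V) : 0 < likelihood c a v := exp_pos _

theorem gaussDensity_mul_likelihood (c : ℝ) (a v : V) :
    gaussDensity c v * likelihood c a v = gaussDensity c (v - a) := by
  unfold gaussDensity likelihood
  rw [mul_assoc, ← exp_add, norm_sub_sq_real]
  congr 2
  ring

@[fun_prop]
theorem continuous_gaussDensity (c : ℝ) : Continuous (gaussDensity c : V → ℝ) := by
  unfold gaussDensity
  fun_prop

/-- The log-likelihood is affine in v. Recentring at a leaves only moments of order zero and one, so
both integrability and the exact relative entropy can be read off. -/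
theorem gaussDensity_mul_klFun_likelihood (c : ℝ) (a v : V) :
    gaussDensity c v * klFun (likelihood c a v) =
      (2 / c) * (gaussDensity c (v - a) * inner ℝ (v - a) a) + (‖a‖ ^ 2 / c) * gaussDensity c (v - a)
        + gaussDensity c v - gaussDensity c (v - a) := by
  have h : inner ℝ (v - a) a = inner ℝ v a - ‖a‖ ^ 2 := by
    rw [inner_sub_left, real_inner_self_eq_norm_sq]
  rw [klFun_apply, h, ← gaussDensity_mul_likelihood c a v]
  conv_lhs => rw [likelihood, log_exp, ← likelihood]
  ring

variable [FiniteDimensional ℝ V] [MeasurableSpace V] [BorelSpace V]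

theorem integral_gaussDensity {c : ℝ} (hc : 0 < c) : ∫ v : V, gaussDensity c v = 1 := by
  unfold gaussDensity
  rw [integral_const_mul]
  have h := GaussianFourier.integral_rexp_neg_mul_sq_norm (V := V) (inv_pos.2 hc)
  have e : (fun v : V => exp (-(‖v‖ ^ 2 / c))) = fun v => exp (-c⁻¹ * ‖v‖ ^ 2) := by
    funext v
    congr 1
    field_simp
  rw [e, h, div_inv_eq_mul, mul_comm π c]
  have : 0 < (c * π) ^ ((Module.finrank ℝ V : ℝ) / 2) := by positivity
  field_simp

theorem integrable_exp_neg_mul_sq_norm {b : ℝ} (hb : 0 < b) :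
    Integrable fun v : V => exp (-b * ‖v‖ ^ 2) := by
  have h := (GaussianFourier.integrable_cexp_neg_mul_sq_norm_add (V := V) (b := (b : ℂ))
    (by simpa using hb) 0 0).re
  refine h.congr (Eventually.of_forall fun v => ?_)
  have : (-(b : ℂ) * (‖v‖ : ℂ) ^ 2 + 0 * ((inner ℝ (0 : V) v : ℝ) : ℂ))
      = ((-b * ‖v‖ ^ 2 : ℝ) : ℂ) := by
    push_cast
    ring
  simp only [this, ← Complex.ofReal_exp]
  exact Complex.ofReal_re _

theorem integrable_gaussDensity_mul_exp {c : ℝ} (hc : 0 < c) (K : ℝ) :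
    Integrable fun v : V => gaussDensity c v * exp (K * ‖v‖) := by
  have h := (integrable_exp_neg_mul_sq_norm (V := V) (b := (2 * c)⁻¹) (by positivity)).const_mul
    (1 / (c * π) ^ ((Module.finrank ℝ V : ℝ) / 2) * exp (K ^ 2 * c / 2))
  refine h.mono' (by fun_prop) (Eventually.of_forall fun v => ?_)
  have hp : 0 ≤ gaussDensity c v * exp (K * ‖v‖) :=
    mul_nonneg (gaussDensity_pos hc v).le (exp_pos _).le
  rw [Real.norm_of_nonneg hp]
  unfold gaussDensity
  rw [mul_assoc, mul_assoc, ← exp_add, ← exp_add]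
  refine mul_le_mul_of_nonneg_left (exp_le_exp.2 ?_) (by positivity)
  -- Completing the square: K‖v‖ ≤ ‖v‖²/(2c) + K²c/2, so half of the Gaussian exponent absorbs the
  -- exponential growth.
  have h2 : 0 ≤ (‖v‖ - K * c) ^ 2 / (2 * c) := by positivity
  have e : (‖v‖ - K * c) ^ 2 / (2 * c)
      = K ^ 2 * c / 2 + -(2 * c)⁻¹ * ‖v‖ ^ 2 - (-(‖v‖ ^ 2 / c) + K * ‖v‖) := by
    field_simp
    ring
  linarith

theorem integrable_gaussDensity {c : ℝ} (hc : 0 < c) :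
    Integrable (gaussDensity c : V → ℝ) := by
  simpa using integrable_gaussDensity_mul_exp (V := V) hc 0

/-- A continuous function of at most exponential growth is integrable against a Gaussian. -/
theorem integrable_gaussDensity_mul_of_le {c : ℝ} (hc : 0 < c) {f : V → ℝ} (hf : Continuous f)
    {A K : ℝ} (hA : ∀ v, |f v| ≤ A * exp (K * ‖v‖)) :
    Integrable fun v : V => gaussDensity c v * f v := by
  refine ((integrable_gaussDensity_mul_exp (V := V) hc K).const_mul A).mono'
    (by fun_prop) (Eventually.of_forall fun v => ?_)
  rw [norm_mul, Real.norm_of_nonneg (gaussDensity_pos hc v).le, Real.norm_eq_abs]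
  calc gaussDensity c v * |f v| ≤ gaussDensity c v * (A * exp (K * ‖v‖)) :=
        mul_le_mul_of_nonneg_left (hA v) (gaussDensity_pos hc v).le
    _ = _ := by ring

theorem integrable_gaussDensity_mul_likelihood {c : ℝ} (hc : 0 < c) (a : V) :
    Integrable fun v : V => gaussDensity c v * likelihood c a v := by
  simp only [gaussDensity_mul_likelihood]
  exact (integrable_gaussDensity hc).comp_sub_right a

theorem integral_gaussDensity_mul_likelihood {c : ℝ} (hc : 0 < c) (a : V) :
    ∫ v : V, gaussDensity c v * likelihood c a v = 1 := by
  simp only [gaussDensity_mul_likelihood]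
  rw [integral_sub_right_eq_self (fun v => gaussDensity c v) a, integral_gaussDensity hc]

theorem integrable_gaussDensity_mul_inner {c : ℝ} (hc : 0 < c) (a : V) :
    Integrable fun v : V => gaussDensity c v * inner ℝ v a := by
  refine integrable_gaussDensity_mul_of_le hc (by fun_prop) (A := ‖a‖) (K := 1) fun v => ?_
  calc |inner ℝ v a| ≤ ‖v‖ * ‖a‖ := abs_real_inner_le_norm v a
    _ ≤ ‖a‖ * exp (1 * ‖v‖) := by
      rw [mul_comm, one_mul]
      refine mul_le_mul_of_nonneg_left ?_ (norm_nonneg a)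
      linarith [add_one_le_exp ‖v‖]

theorem integral_gaussDensity_mul_inner {c : ℝ} (a : V) :
    ∫ v : V, gaussDensity c v * inner ℝ v a = 0 := by
  have h := integral_neg_eq_self (fun v : V => gaussDensity c v * inner ℝ v a) volume
  have e : ∀ v : V, gaussDensity c (-v) * inner ℝ (-v) a = -(gaussDensity c v * inner ℝ v a) := by
    intro v
    simp [gaussDensity]
  simp only [e, integral_neg] at h
  linarith

theorem integrable_gaussDensity_mul_klFun_likelihood {c : ℝ} (hc : 0 < c) (a : V) :
    Integrable fun v : V => gaussDensity c v * klFun (likelihood c a v) := by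
  simp only [gaussDensity_mul_klFun_likelihood]
  have h1 := (integrable_gaussDensity (V := V) hc).comp_sub_right a
  have h2 := (integrable_gaussDensity_mul_inner (V := V) hc a).comp_sub_right a
  exact (((h2.const_mul _).add (h1.const_mul _)).add (integrable_gaussDensity hc)).sub h1

theorem integral_gaussDensity_mul_klFun_likelihood {c : ℝ} (hc : 0 < c) (a : V) :
    ∫ v : V, gaussDensity c v * klFun (likelihood c a v) = ‖a‖ ^ 2 / c := by
  simp only [gaussDensity_mul_klFun_likelihood]
  have h1 := (integrable_gaussDensity (V := V) hc).comp_sub_right a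
  have h2 := (integrable_gaussDensity_mul_inner (V := V) hc a).comp_sub_right a
  rw [integral_sub, integral_add, integral_add, integral_const_mul, integral_const_mul,
    integral_sub_right_eq_self (fun v => gaussDensity c v) a,
    integral_sub_right_eq_self (fun v => gaussDensity c v * inner ℝ v a) a,
    integral_gaussDensity hc, integral_gaussDensity_mul_inner]
  · ring
  · exact h2.const_mul _
  · exact h1.const_mul _
  · exact (h2.const_mul _).add (h1.const_mul _)
  · exact integrable_gaussDensity hc
  · exact ((h2.const_mul _).add (h1.const_mul _)).add (integrable_gaussDensity hc)
  · exact h1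

end Gaussian

end BICM

namespace BICM

open Filter Topology InformationTheory Real

/-! ### Relative entropy of Gaussian mixtures -/

section Mixture

variable {V : Type*} [NormedAddCommGroup V] [InnerProductSpace ℝ V] {ι : Type*} [Fintype ι]

/-- The density of a mixture of shifted Gaussian laws relative to the centred one. -/
def mixtureLikelihood (c : ℝ) (w : ι → ℝ) (a : ι → V) (v : V) : ℝ :=
  ∑ i, w i * likelihood c (a i) v

@[fun_prop]
theorem continuous_mixtureLikelihood (c : ℝ) (w : ι → ℝ) (a : ι → V) :
    Continuous (mixtureLikelihood c w a) := by
  unfold mixtureLikelihood likelihood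
  fun_prop

theorem mixtureLikelihood_pos (c : ℝ) {w : ι → ℝ} (hw : w ∈ stdSimplex ℝ ι) (a : ι → V) (v : V) :
    0 < mixtureLikelihood c w a v := by
  have h0 : ∀ i ∈ Finset.univ, 0 ≤ w i * likelihood c (a i) v :=
    fun i _ => mul_nonneg (hw.1 i) (likelihood_pos c _ v).le
  refine (Finset.sum_nonneg h0).lt_of_ne fun h => ?_
  have h1 := (Finset.sum_eq_zero_iff_of_nonneg h0).1 h.symm
  have h2 : ∀ i, w i = 0 := fun i =>
    (mul_eq_zero.1 (h1 i (Finset.mem_univ i))).resolve_right (likelihood_pos c _ v).ne'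
  have h3 := hw.2
  simp [h2] at h3

/-- Jensen's inequality. It reduces integrability for a mixture to that of its components, and
yields the quadratic bound in `mixtureKL_le`. -/
theorem klFun_mixtureLikelihood_le (c : ℝ) {w : ι → ℝ} (hw : w ∈ stdSimplex ℝ ι) (a : ι → V)
    (v : V) : klFun (mixtureLikelihood c w a v) ≤ ∑ i, w i * klFun (likelihood c (a i) v) :=
  convexOn_klFun.map_sum_le (fun i _ => hw.1 i) hw.2 fun i _ => (likelihood_pos c (a i) v).le

theorem hasDerivAt_mixtureLikelihood_smul (c : ℝ) (w : ι → ℝ) (a : ι → V) (v : V) :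
    HasDerivAt (fun t : ℝ => mixtureLikelihood c w (t • a) v)
      (2 / c * inner ℝ v (∑ i, w i • a i)) 0 := by
  unfold mixtureLikelihood likelihood
  have h : ∀ i, HasDerivAt
      (fun t : ℝ => w i * exp ((2 * inner ℝ v ((t • a) i) - ‖(t • a) i‖ ^ 2) / c))
      (w i * (2 / c * inner ℝ v (a i))) 0 := by
    intro i
    have e : ∀ t : ℝ, (2 * inner ℝ v ((t • a) i) - ‖(t • a) i‖ ^ 2) / c
        = (t * (2 * inner ℝ v (a i)) - t ^ 2 * ‖a i‖ ^ 2) / c := by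
      intro t
      rw [Pi.smul_apply, inner_smul_right, norm_smul, mul_pow, Real.norm_eq_abs, sq_abs]
      ring
    simp only [e]
    have h1 : HasDerivAt (fun t : ℝ => (t * (2 * inner ℝ v (a i)) - t ^ 2 * ‖a i‖ ^ 2) / c)
        ((1 * (2 * inner ℝ v (a i)) - (2 * 0 ^ (2 - 1)) * ‖a i‖ ^ 2) / c) 0 := by
      simpa using (((hasDerivAt_id (0 : ℝ)).mul_const (2 * inner ℝ v (a i))).sub
        ((hasDerivAt_pow 2 (0 : ℝ)).mul_const (‖a i‖ ^ 2))).div_const c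
    convert! (h1.exp).const_mul (w i) using 1
    simp only [zero_mul, ne_eq, OfNat.ofNat_ne_zero, not_false_eq_true, zero_pow, sub_self,
      zero_div, exp_zero, one_mul]
    ring
  convert! HasDerivAt.fun_sum (u := Finset.univ) fun i _ => h i using 1
  rw [inner_sum, Finset.mul_sum]
  refine Finset.sum_congr rfl fun i _ => ?_
  rw [inner_smul_right]
  ring

/-- Provides a dominating function, uniform in small t, of exponential growth in ‖v‖ and hence
integrable against the Gaussian. It follows from `klFun_le_sq`, since each likelihood differs from 1
by O(|t|). -/
theorem klFun_mixtureLikelihood_smul_le {c : ℝ} (hc : 0 < c) {w : ι → ℝ}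
    (hw : w ∈ stdSimplex ℝ ι) (a : ι → V) (v : V) {t : ℝ} (ht : |t| ≤ 1) :
    klFun (mixtureLikelihood c w (t • a) v) ≤
      t ^ 2 * exp (4 * ((2 * ‖v‖ * (∑ i, ‖a i‖) + (∑ i, ‖a i‖) ^ 2) / c)) := by
  set A := ∑ i, ‖a i‖
  set B := (2 * ‖v‖ * A + A ^ 2) / c
  have hA : 0 ≤ A := Finset.sum_nonneg fun i _ => norm_nonneg _
  have hB : 0 ≤ B := by positivity
  have haA : ∀ i, ‖a i‖ ≤ A := fun i =>
    Finset.single_le_sum (f := fun i => ‖a i‖) (fun j _ => norm_nonneg _) (Finset.mem_univ i)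
  have hL : ∀ i, |likelihood c ((t • a) i) v - 1| ≤ |t| * (B * exp B) := by
    intro i
    have he : |(2 * inner ℝ v ((t • a) i) - ‖(t • a) i‖ ^ 2) / c| ≤ |t| * B := by
      rw [abs_div, abs_of_pos hc, div_le_iff₀ hc, Pi.smul_apply, inner_smul_right, norm_smul,
        mul_pow, Real.norm_eq_abs]
      have h1 : |inner ℝ v (a i)| ≤ ‖v‖ * A := (abs_real_inner_le_norm v (a i)).trans
        (mul_le_mul_of_nonneg_left (haA i) (norm_nonneg v))
      have h2 : |t| ^ 2 * ‖a i‖ ^ 2 ≤ |t| * A ^ 2 := by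
        have h3 : |t| ^ 2 ≤ |t| := by nlinarith [abs_nonneg t]
        exact mul_le_mul h3 (pow_le_pow_left₀ (norm_nonneg _) (haA i) 2) (by positivity)
          (abs_nonneg t)
      have h4 : |2 * (t * inner ℝ v (a i))| ≤ |t| * (2 * ‖v‖ * A) := by
        rw [abs_mul, abs_mul, abs_two]
        nlinarith [mul_le_mul_of_nonneg_left h1 (abs_nonneg t)]
      have h5 : |t| * B * c = |t| * (2 * ‖v‖ * A) + |t| * A ^ 2 := by
        simp only [B]
        field_simp
      rw [h5]
      refine (abs_sub _ _).trans (add_le_add h4 ?_)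
      rwa [abs_of_nonneg (by positivity)]
    refine (abs_exp_sub_one_le_mul_exp _).trans ?_
    have h6 : |t| * B ≤ B := mul_le_of_le_one_left hB ht
    rw [← mul_assoc]
    exact mul_le_mul he (exp_le_exp.2 (he.trans h6)) (exp_pos _).le (by positivity)
  have hR : |mixtureLikelihood c w (t • a) v - 1| ≤ |t| * (B * exp B) := by
    have e : mixtureLikelihood c w (t • a) v - 1
        = ∑ i, w i * (likelihood c ((t • a) i) v - 1) := by
      simp only [mul_sub, mul_one, Finset.sum_sub_distrib, hw.2, mixtureLikelihood]
    rw [e]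
    refine (Finset.abs_sum_le_sum_abs _ _).trans ?_
    calc ∑ i, |w i * (likelihood c ((t • a) i) v - 1)|
        ≤ ∑ i, w i * (|t| * (B * exp B)) := Finset.sum_le_sum fun i _ => by
          rw [abs_mul, abs_of_nonneg (hw.1 i)]
          exact mul_le_mul_of_nonneg_left (hL i) (hw.1 i)
      _ = _ := by rw [← Finset.sum_mul, hw.2, one_mul]
  refine (klFun_le_sq (mixtureLikelihood_pos c hw _ v)).trans ?_
  rw [← sq_abs]
  refine (pow_le_pow_left₀ (abs_nonneg _) hR 2).trans ?_
  rw [mul_pow, sq_abs]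
  refine mul_le_mul_of_nonneg_left ?_ (sq_nonneg t)
  -- Trades the polynomial factor for an exponential one; this is where the constant 4 in the
  -- exponent arises.
  have h7 : B ≤ exp B := by linarith [add_one_le_exp B]
  calc (B * exp B) ^ 2 ≤ (exp B * exp B) ^ 2 := by gcongr
    _ = exp (4 * B) := by
      rw [← exp_add, ← exp_nat_mul]
      congr 1
      push_cast
      ring

theorem gaussDensity_mul_klFun_mixtureLikelihood_nonneg {c : ℝ} (hc : 0 < c) {w : ι → ℝ}
    (hw : w ∈ stdSimplex ℝ ι) (a : ι → V) (v : V) :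
    0 ≤ gaussDensity c v * klFun (mixtureLikelihood c w a v) :=
  mul_nonneg (gaussDensity_pos hc v).le (klFun_nonneg (mixtureLikelihood_pos c hw a v).le)

theorem gaussDensity_mul_klFun_mixtureLikelihood_le {c : ℝ} (hc : 0 < c) {w : ι → ℝ}
    (hw : w ∈ stdSimplex ℝ ι) (a : ι → V) (v : V) :
    gaussDensity c v * klFun (mixtureLikelihood c w a v)
      ≤ ∑ i, w i * (gaussDensity c v * klFun (likelihood c (a i) v)) := by
  refine (mul_le_mul_of_nonneg_left (klFun_mixtureLikelihood_le c hw a v)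
    (gaussDensity_pos hc v).le).trans_eq ?_
  rw [Finset.mul_sum]
  exact Finset.sum_congr rfl fun i _ => by ring

variable [FiniteDimensional ℝ V] [MeasurableSpace V] [BorelSpace V]

/-- The relative entropy of a mixture of shifted Gaussian laws with respect to the centred one. -/
def mixtureKL (c : ℝ) (w : ι → ℝ) (a : ι → V) : ℝ :=
  ∫ v, gaussDensity c v * klFun (mixtureLikelihood c w a v)

theorem integrable_gaussDensity_mul_mixtureLikelihood {c : ℝ} (hc : 0 < c) (w : ι → ℝ) (a : ι → V) :
    Integrable fun v => gaussDensity c v * mixtureLikelihood c w a v := by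
  unfold mixtureLikelihood
  simp only [Finset.mul_sum]
  refine integrable_finsetSum _ fun i _ => ?_
  refine ((integrable_gaussDensity_mul_likelihood hc (a i)).const_mul (w i)).congr
    (Eventually.of_forall fun v => ?_)
  simp only
  ring

theorem integral_gaussDensity_mul_mixtureLikelihood {c : ℝ} (hc : 0 < c) {w : ι → ℝ}
    (hw : w ∈ stdSimplex ℝ ι) (a : ι → V) :
    ∫ v, gaussDensity c v * mixtureLikelihood c w a v = 1 := by
  have e : ∀ v, gaussDensity c v * mixtureLikelihood c w a v
      = ∑ i, w i * (gaussDensity c v * likelihood c (a i) v) := by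
    intro v
    rw [mixtureLikelihood, Finset.mul_sum]
    exact Finset.sum_congr rfl fun i _ => by ring
  simp only [e]
  rw [integral_finsetSum _ fun i _ =>
    (integrable_gaussDensity_mul_likelihood hc (a i)).const_mul (w i)]
  simp only [integral_const_mul, integral_gaussDensity_mul_likelihood hc, mul_one, hw.2]

theorem integrable_gaussDensity_mul_klFun_mixtureLikelihood {c : ℝ} (hc : 0 < c) {w : ι → ℝ}
    (hw : w ∈ stdSimplex ℝ ι) (a : ι → V) :
    Integrable fun v => gaussDensity c v * klFun (mixtureLikelihood c w a v) := by
  refine (integrable_finsetSum Finset.univ fun i _ =>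
    (integrable_gaussDensity_mul_klFun_likelihood hc (a i)).const_mul (w i)).mono'
    (by fun_prop) (Eventually.of_forall fun v => ?_)
  rw [Real.norm_of_nonneg (gaussDensity_mul_klFun_mixtureLikelihood_nonneg hc hw a v)]
  exact gaussDensity_mul_klFun_mixtureLikelihood_le hc hw a v

theorem mixtureKL_nonneg {c : ℝ} (hc : 0 < c) {w : ι → ℝ}
    (hw : w ∈ stdSimplex ℝ ι) (a : ι → V) : 0 ≤ mixtureKL c w a :=
  integral_nonneg (gaussDensity_mul_klFun_mixtureLikelihood_nonneg hc hw a)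

/-- Convexity of relative entropy, with the exact value ‖a‖²/c for one shift. The bound is quadratic
at every amplitude, so a finite second moment of the fading suffices for domination. -/
theorem mixtureKL_le {c : ℝ} (hc : 0 < c) {w : ι → ℝ}
    (hw : w ∈ stdSimplex ℝ ι) (a : ι → V) : mixtureKL c w a ≤ ∑ i, w i * (‖a i‖ ^ 2 / c) := by
  have hi : ∀ i ∈ Finset.univ, Integrable fun v : V =>
      w i * (gaussDensity c v * klFun (likelihood c (a i) v)) := fun i _ =>
    (integrable_gaussDensity_mul_klFun_likelihood hc (a i)).const_mul (w i)
  refine (integral_mono (integrable_gaussDensity_mul_klFun_mixtureLikelihood hc hw a)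
    (integrable_finsetSum Finset.univ hi)
    (gaussDensity_mul_klFun_mixtureLikelihood_le hc hw a)).trans_eq ?_
  rw [integral_finsetSum _ hi]
  simp only [integral_const_mul, integral_gaussDensity_mul_klFun_likelihood hc]

/-- Pointwise, the mixture likelihood is 1 + t(2/c)⟨v, mean⟩ + o(t), and the integrand is quadratic
in the deviation from 1 with coefficient 1/2; dominated convergence does the rest. -/
theorem tendsto_mixtureKL_smul_div_sq_integral {c : ℝ} (hc : 0 < c) {w : ι → ℝ}
    (hw : w ∈ stdSimplex ℝ ι) (a : ι → V) :
    Tendsto (fun t : ℝ => mixtureKL c w (t • a) / t ^ 2) (𝓝[≠] 0)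
      (𝓝 (∫ v, gaussDensity c v * ((2 / c * inner ℝ v (∑ i, w i • a i)) ^ 2 / 2))) := by
  unfold mixtureKL
  simp only [← integral_div]
  set A := ∑ i, ‖a i‖
  refine tendsto_integral_filter_of_dominated_convergence
    (fun v => exp (4 * A ^ 2 / c) * (gaussDensity c v * exp (8 * A / c * ‖v‖))) ?_ ?_ ?_ ?_
  · exact Eventually.of_forall fun t => by fun_prop
  · have h1 : ∀ᶠ t : ℝ in 𝓝[≠] 0, |t| ≤ 1 := by
      refine nhdsWithin_le_nhds ?_
      filter_upwards [Metric.closedBall_mem_nhds (0 : ℝ) one_pos] with t ht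
      simpa using ht
    filter_upwards [self_mem_nhdsWithin, h1] with t h0 ht
    refine Eventually.of_forall fun v => ?_
    have ht2 : 0 < t ^ 2 := by
      have : t ≠ 0 := h0
      positivity
    rw [Real.norm_of_nonneg (div_nonneg
      (gaussDensity_mul_klFun_mixtureLikelihood_nonneg hc hw _ v) ht2.le), div_le_iff₀ ht2]
    refine (mul_le_mul_of_nonneg_left (klFun_mixtureLikelihood_smul_le hc hw a v ht)
      (gaussDensity_pos hc v).le).trans_eq ?_
    have e : 4 * ((2 * ‖v‖ * A + A ^ 2) / c) = 4 * A ^ 2 / c + 8 * A / c * ‖v‖ := by ring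
    rw [e, exp_add]
    ring
  · exact (integrable_gaussDensity_mul_exp hc _).const_mul _
  · refine Eventually.of_forall fun v => ?_
    simp only [mul_div_assoc]
    refine (tendsto_klFun_comp_div_sq (hasDerivAt_mixtureLikelihood_smul c w a v) ?_).const_mul _
    simp [mixtureLikelihood, likelihood, hw.2]

/-- The Gaussian second moment comes from uniqueness of limits: for a one-component mixture the
relative entropy is exactly t²‖a‖²/c, while the preceding limit is the integral sought. -/
theorem integral_gaussDensity_mul_inner_sq {c : ℝ} (hc : 0 < c) (a : V) :
    ∫ v, gaussDensity c v * ((2 / c * inner ℝ v a) ^ 2 / 2) = ‖a‖ ^ 2 / c := by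
  have hw : (fun _ => 1 : Unit → ℝ) ∈ stdSimplex ℝ Unit := ⟨fun _ => zero_le_one, by simp⟩
  have h := tendsto_mixtureKL_smul_div_sq_integral hc hw fun _ => a
  simp only [Finset.univ_unique, Finset.sum_const, Finset.card_singleton, one_smul] at h
  refine tendsto_nhds_unique h (tendsto_const_nhds.congr' ?_)
  filter_upwards [self_mem_nhdsWithin] with t ht
  have ht : t ≠ 0 := ht
  simp only [mixtureKL, mixtureLikelihood, Finset.univ_unique, Finset.sum_singleton, one_mul,
    integral_gaussDensity_mul_klFun_likelihood hc, Pi.smul_apply, norm_smul, mul_pow,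
    Real.norm_eq_abs, sq_abs]
  field_simp

theorem tendsto_mixtureKL_smul_div_sq {c : ℝ} (hc : 0 < c) {w : ι → ℝ} (hw : w ∈ stdSimplex ℝ ι)
    (a : ι → V) :
    Tendsto (fun t : ℝ => mixtureKL c w (t • a) / t ^ 2) (𝓝[≠] 0)
      (𝓝 (‖∑ i, w i • a i‖ ^ 2 / c)) := by
  rw [← integral_gaussDensity_mul_inner_sq hc]
  exact tendsto_mixtureKL_smul_div_sq_integral hc hw a

theorem integrable_gaussDensity_mul_mixtureLikelihood_mul_log {c : ℝ} (hc : 0 < c) {w : ι → ℝ}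
    (hw : w ∈ stdSimplex ℝ ι) (a : ι → V) :
    Integrable fun v => gaussDensity c v *
      (mixtureLikelihood c w a v * log (mixtureLikelihood c w a v)) := by
  refine (((integrable_gaussDensity_mul_klFun_mixtureLikelihood hc hw a).add
    (integrable_gaussDensity_mul_mixtureLikelihood hc w a)).sub
    (integrable_gaussDensity hc)).congr (Eventually.of_forall fun v => ?_)
  simp only [Pi.add_apply, Pi.sub_apply, klFun_apply]
  ring

/-- The correction 1 - x in `klFun` integrates to zero because both densities have mass one. -/
theorem mixtureKL_eq {c : ℝ} (hc : 0 < c) {w : ι → ℝ} (hw : w ∈ stdSimplex ℝ ι) (a : ι → V) :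
    mixtureKL c w a = ∫ v, gaussDensity c v *
      (mixtureLikelihood c w a v * log (mixtureLikelihood c w a v)) := by
  have e : ∀ v, gaussDensity c v * klFun (mixtureLikelihood c w a v) = gaussDensity c v *
      (mixtureLikelihood c w a v * log (mixtureLikelihood c w a v)) + gaussDensity c v
      - gaussDensity c v * mixtureLikelihood c w a v := by
    intro v
    rw [klFun_apply]
    ring
  have h := integrable_gaussDensity_mul_mixtureLikelihood_mul_log hc hw a
  unfold mixtureKL
  simp only [e]
  rw [integral_sub, integral_add, integral_gaussDensity hc,
    integral_gaussDensity_mul_mixtureLikelihood hc hw]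
  · ring
  · exact h
  · exact integrable_gaussDensity hc
  · exact h.add (integrable_gaussDensity hc)
  · exact integrable_gaussDensity_mul_mixtureLikelihood hc w a

/-- The mutual information between the component of a two-level Gaussian mixture and the output,
as a difference of relative entropies. -/
theorem sum_integral_mixtureLikelihood_mul_log_div {κ : Type*} [Fintype κ] {c : ℝ} (hc : 0 < c)
    {p : κ → ℝ} (hp : ∀ u, 0 < p u) {w : κ → ι → ℝ} (hw : ∀ u, w u ∈ stdSimplex ℝ ι)
    {W : ι → ℝ} (hW : W ∈ stdSimplex ℝ ι) (hpw : ∀ i, ∑ u, p u * w u i = W i) (a : ι → V) :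
    ∑ u, p u * ∫ v, gaussDensity c v * mixtureLikelihood c (w u) a v *
        log (mixtureLikelihood c (w u) a v / mixtureLikelihood c W a v)
      = ∑ u, p u * mixtureKL c (w u) a - mixtureKL c W a := by
  have hsum : ∀ v, ∑ u, p u * mixtureLikelihood c (w u) a v = mixtureLikelihood c W a v := by
    intro v
    simp only [mixtureLikelihood, Finset.mul_sum]
    rw [Finset.sum_comm]
    refine Finset.sum_congr rfl fun i _ => ?_
    rw [← hpw i, Finset.sum_mul]
    exact Finset.sum_congr rfl fun u _ => by ring
  -- A component is at most a constant times the mixture, so the cross term is dominated by the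
  -- mixture's own entropy integrand.
  have hle : ∀ u v, mixtureLikelihood c (w u) a v ≤ (p u)⁻¹ * mixtureLikelihood c W a v := by
    intro u v
    rw [← hsum v, le_inv_mul_iff₀ (hp u)]
    exact Finset.single_le_sum (f := fun u => p u * mixtureLikelihood c (w u) a v)
      (fun u _ => (mul_pos (hp u) (mixtureLikelihood_pos c (hw u) a v)).le) (Finset.mem_univ u)
  have hWint := integrable_gaussDensity_mul_mixtureLikelihood_mul_log hc hW a
  have hcont : Continuous fun v => log (mixtureLikelihood c W a v) :=
    (continuous_mixtureLikelihood c W a).log fun v => (mixtureLikelihood_pos c hW a v).ne'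
  have hcross : ∀ u, Integrable fun v => gaussDensity c v *
      (mixtureLikelihood c (w u) a v * log (mixtureLikelihood c W a v)) := by
    intro u
    refine (hWint.norm.const_mul (p u)⁻¹).mono' (by fun_prop) (Eventually.of_forall fun v => ?_)
    simp only [norm_mul, Real.norm_of_nonneg (gaussDensity_pos hc v).le,
      Real.norm_of_nonneg (mixtureLikelihood_pos c (hw u) a v).le,
      Real.norm_of_nonneg (mixtureLikelihood_pos c hW a v).le]
    have h := mul_le_mul_of_nonneg_right (hle u v)
      (mul_nonneg (gaussDensity_pos hc v).le (norm_nonneg (log (mixtureLikelihood c W a v))))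
    linarith
  have hsplit : ∀ u, ∫ v, gaussDensity c v * mixtureLikelihood c (w u) a v *
        log (mixtureLikelihood c (w u) a v / mixtureLikelihood c W a v)
      = mixtureKL c (w u) a - ∫ v, gaussDensity c v *
        (mixtureLikelihood c (w u) a v * log (mixtureLikelihood c W a v)) := by
    intro u
    rw [mixtureKL_eq hc (hw u), ← integral_sub
      (integrable_gaussDensity_mul_mixtureLikelihood_mul_log hc (hw u) a) (hcross u)]
    congr 1
    funext v
    rw [log_div (mixtureLikelihood_pos c (hw u) a v).ne' (mixtureLikelihood_pos c hW a v).ne']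
    ring
  -- The logarithm does not depend on u, so averaging the cross terms over u rebuilds the mixture.
  have hW2 : mixtureKL c W a = ∑ u, p u * ∫ v, gaussDensity c v *
        (mixtureLikelihood c (w u) a v * log (mixtureLikelihood c W a v)) := by
    simp only [← integral_const_mul]
    rw [mixtureKL_eq hc hW, ← integral_finsetSum _ fun u _ => (hcross u).const_mul (p u)]
    congr 1
    funext v
    conv_lhs => rw [← hsum v, Finset.sum_mul, Finset.mul_sum, hsum v]
    exact Finset.sum_congr rfl fun u _ => by ring
  simp only [hsplit, mul_sub, Finset.sum_sub_distrib]
  rw [← hW2]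

end Mixture

end BICM

namespace BICM

/-! ### Indices as bit vectors -/

section Bits

variable {m : ℕ}

theorem nbc_bijective : Function.Bijective (nbc : Fin (2 ^ m) → Fin m → Bool) := by
  rw [Fintype.bijective_iff_injective_and_card]
  refine ⟨fun i j h => Fin.ext (Nat.eq_of_testBit_eq fun k => ?_), by simp⟩
  by_cases hk : k < m
  · exact congrFun h ⟨k, hk⟩
  · have hp : 2 ^ m ≤ 2 ^ k := Nat.pow_le_pow_right two_pos (not_lt.1 hk)
    rw [Nat.testBit_lt_two_pow (i.isLt.trans_le hp), Nat.testBit_lt_two_pow (j.isLt.trans_le hp)]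

/-- Distributivity over all bit vectors; this is the source of both the Hadamard orthogonality and
the independence of the bits. -/
theorem sum_prod_nbc (F : Fin m → Bool → ℝ) :
    ∑ i : Fin (2 ^ m), ∏ k, F k (nbc i k) = ∏ k, ∑ u, F k u := by
  rw [nbc_bijective.sum_comp fun v : Fin m → Bool => ∏ k, F k (v k), Finset.prod_univ_sum,
    Fintype.piFinset_univ]

theorem nbc_zeroIdx (k : Fin m) : nbc (zeroIdx m) k = false := by
  simp [nbc, zeroIdx]

theorem nbc_powTwo (k l : Fin m) : nbc (powTwo k) l = decide (k = l) := by
  simp [nbc, powTwo, Nat.testBit_two_pow, Fin.ext_iff]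

theorem powTwo_injective : Function.Injective (powTwo : Fin m → Fin (2 ^ m)) := fun k l h => by
  have := congrArg Fin.val h
  exact Fin.ext (Nat.pow_right_injective le_rfl this)

theorem powTwo_ne_zeroIdx (k : Fin m) : powTwo k ≠ zeroIdx m := fun h => by
  have := congrArg Fin.val h
  simp [powTwo, zeroIdx] at this

end Bits

/-! ### Hadamard inversion and the spectrum of sums of one-bit functions -/

section Hadamard

variable {m N : ℕ}

theorem hadamardCoeff_zeroIdx (i : Fin (2 ^ m)) : hadamardCoeff i (zeroIdx m) = 1 := by
  simp [hadamardCoeff, nbc_zeroIdx]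

theorem hadamardCoeff_powTwo (i : Fin (2 ^ m)) (k : Fin m) :
    hadamardCoeff i (powTwo k) = (-1) ^ (nbc i k).toNat := by
  unfold hadamardCoeff
  rw [Finset.prod_eq_single k]
  · simp [nbc_powTwo]
  · intro l _ hl
    simp [nbc_powTwo, hl.symm]
  · simp

/-- The sum factors over the bits: a factor is 2 where i and l agree and 1 - 1 = 0 where they
differ. -/
theorem sum_hadamardCoeff_mul (i l : Fin (2 ^ m)) :
    ∑ j, hadamardCoeff i j * hadamardCoeff j l = if i = l then (2 : ℝ) ^ m else 0 := by
  have e := sum_prod_nbc fun k u =>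
    (-1 : ℝ) ^ ((nbc i k).toNat * u.toNat) * (-1 : ℝ) ^ (u.toNat * (nbc l k).toNat)
  simp only [Finset.prod_mul_distrib] at e
  unfold hadamardCoeff
  rw [e]
  split_ifs with h
  · subst h
    refine (Finset.prod_congr rfl fun k _ => ?_).trans (Fin.prod_const m 2)
    cases nbc i k <;> norm_num
  · have hk : ∃ k, nbc i k ≠ nbc l k := by
      by_contra! h2
      exact h (nbc_bijective.1 (funext h2))
    obtain ⟨k, hk⟩ := hk
    refine Finset.prod_eq_zero (Finset.mem_univ k) ?_
    revert hk
    cases nbc i k <;> cases nbc l k <;> simp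

theorem hadamard_sum_smul (y : Fin (2 ^ m) → EuclideanSpace ℝ (Fin N)) :
    hadamard (fun i => ∑ j, hadamardCoeff i j • y j) = y := by
  funext i
  unfold hadamard
  simp only [Finset.smul_sum, smul_smul]
  rw [Finset.sum_comm]
  have e : ∀ l, ∑ j, (1 / (2 : ℝ) ^ m * (hadamardCoeff i j * hadamardCoeff j l)) • y l
      = if i = l then y l else 0 := by
    intro l
    rw [← Finset.sum_smul, ← Finset.mul_sum, sum_hadamardCoeff_mul]
    split_ifs
    · rw [one_div_mul_cancel (by positivity), one_smul]
    · rw [mul_zero, zero_smul]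
  simp only [e, Finset.sum_ite_eq, Finset.mem_univ, if_true]

theorem sum_smul_hadamard (X : Fin (2 ^ m) → EuclideanSpace ℝ (Fin N)) (i : Fin (2 ^ m)) :
    ∑ j, hadamardCoeff i j • hadamard X j = X i := by
  unfold hadamard
  simp only [Finset.smul_sum, smul_smul]
  rw [Finset.sum_comm]
  have e : ∀ l, ∑ j, (hadamardCoeff i j * (1 / (2 : ℝ) ^ m * hadamardCoeff j l)) • X l
      = if i = l then X l else 0 := by
    intro l
    have e2 : ∀ j, hadamardCoeff i j * (1 / (2 : ℝ) ^ m * hadamardCoeff j l)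
        = 1 / (2 : ℝ) ^ m * (hadamardCoeff i j * hadamardCoeff j l) := fun j => by ring
    simp only [e2]
    rw [← Finset.sum_smul, ← Finset.mul_sum, sum_hadamardCoeff_mul]
    split_ifs
    · rw [one_div_mul_cancel (by positivity), one_smul]
    · rw [mul_zero, zero_smul]
  simp only [e, Finset.sum_ite_eq, Finset.mem_univ, if_true]

theorem sum_eq_zeroIdx_add_sum_powTwo {E : Type*} [AddCommMonoid E] {g : Fin (2 ^ m) → E}
    (hg : ∀ j, j ≠ zeroIdx m → (∀ k, j ≠ powTwo k) → g j = 0) :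
    ∑ j, g j = g (zeroIdx m) + ∑ k, g (powTwo k) := by
  classical
  rw [← Finset.sum_image (s := Finset.univ) (g := powTwo) (f := g) powTwo_injective.injOn,
    ← Finset.sum_insert]
  · symm
    refine Finset.sum_subset (Finset.subset_univ _) fun j _ hj => ?_
    simp only [Finset.mem_insert, Finset.mem_image, Finset.mem_univ, true_and, not_or,
      not_exists] at hj
    exact hg j hj.1 fun k h => hj.2 k h.symm
  · simp only [Finset.mem_image, Finset.mem_univ, true_and, not_exists]
    exact fun k => powTwo_ne_zeroIdx k

/-- The alphabet is a sum of centred functions of the individual bits exactly when its Hadamard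
transform is supported on `0` and the powers of two, with the matching value at `0`. -/
theorem exists_centred_iff_hadamard (b : Fin m → ℝ) (X : Fin (2 ^ m) → EuclideanSpace ℝ (Fin N)) :
    (∃ f : Fin m → Bool → EuclideanSpace ℝ (Fin N), (∀ k, ∑ u, bitProb b k u • f k u = 0) ∧
        ∀ i, X i = ∑ k, f k (nbc i k)) ↔
      (hadamard X (zeroIdx m) =
          ∑ k, (bitProb b k true - bitProb b k false) • hadamard X (powTwo k)) ∧
        ∀ j, j ≠ zeroIdx m → (∀ k, j ≠ powTwo k) → hadamard X j = 0 := by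
  constructor
  · rintro ⟨f, hf, hX⟩
    set c : Fin m → EuclideanSpace ℝ (Fin N) := fun k => (1 / 2 : ℝ) • (f k false - f k true)
      with hc
    -- Centring leaves one free vector per bit, the half-difference `c k`, which also fixes the
    -- constant part.
    have hfc : ∀ k u, f k u = ((-1 : ℝ) ^ u.toNat) • c k
        + (bitProb b k true - bitProb b k false) • c k := by
      intro k u
      have h := hf k
      simp only [Fintype.sum_bool, bitProb, if_true, Bool.false_eq_true, if_false] at h ⊢
      have h1 : f k true = b k • (f k true - f k false) := by
        have : f k true - b k • (f k true - f k false)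
            = (1 - b k) • f k true + b k • f k false := by module
        rw [h] at this
        exact sub_eq_zero.1 this
      have h2 : f k false = (1 - b k) • (f k false - f k true) := by
        have : f k false - (1 - b k) • (f k false - f k true)
            = (1 - b k) • f k true + b k • f k false := by module
        rw [h] at this
        exact sub_eq_zero.1 this
      cases u
      · refine h2.trans ?_
        simp only [hc, Bool.toNat_false]
        module
      · refine h1.trans ?_
        simp only [hc, Bool.toNat_true]
        module
    -- The expected spectrum: `c k` at 2^k, and at 0 the total of the constant parts. Its synthesis
    -- is `X`, so inversion identifies it with the transform.
    set y : Fin (2 ^ m) → EuclideanSpace ℝ (Fin N) := fun j =>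
      (if j = zeroIdx m then ∑ k, (bitProb b k true - bitProb b k false) • c k else 0)
        + ∑ k, if j = powTwo k then c k else 0 with hy
    have y0 : y (zeroIdx m) = ∑ k, (bitProb b k true - bitProb b k false) • c k := by
      simp [hy, fun k => (powTwo_ne_zeroIdx (m := m) k).symm]
    have yk : ∀ k, y (powTwo k) = c k := by
      intro k
      simp [hy, powTwo_ne_zeroIdx, powTwo_injective.eq_iff]
    have y1 : ∀ j, j ≠ zeroIdx m → (∀ k, j ≠ powTwo k) → y j = 0 := by
      intro j h0 hk
      simp [hy, h0, hk]
    have hXy : X = fun i => ∑ j, hadamardCoeff i j • y j := by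
      funext i
      rw [sum_eq_zeroIdx_add_sum_powTwo fun j h0 hk => by rw [y1 j h0 hk, smul_zero],
        hadamardCoeff_zeroIdx, y0, one_smul, hX]
      simp only [hadamardCoeff_powTwo, yk, hfc, Finset.sum_add_distrib]
      rw [add_comm]
    have hh : hadamard X = y := by rw [hXy, hadamard_sum_smul]
    rw [hh]
    exact ⟨by simp only [y0, yk], y1⟩
  · rintro ⟨h0, h1⟩
    refine ⟨fun k u => ((-1 : ℝ) ^ u.toNat + (bitProb b k true - bitProb b k false)) •
      hadamard X (powTwo k), fun k => ?_, fun i => ?_⟩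
    · simp only [Fintype.sum_bool, bitProb, if_true, Bool.false_eq_true, if_false,
        Bool.toNat_true, Bool.toNat_false]
      module
    · rw [← sum_smul_hadamard X i,
        sum_eq_zeroIdx_add_sum_powTwo fun j g0 gk => by rw [h1 j g0 gk, smul_zero],
        hadamardCoeff_zeroIdx, h0, one_smul]
      simp only [hadamardCoeff_powTwo, add_smul, Finset.sum_add_distrib]
      rw [add_comm]

end Hadamard

/-! ### Orthogonal projection onto sums of centred one-bit functions -/

section Energy

variable {m N : ℕ}

theorem bitProb_pos {b : Fin m → ℝ} (hb : ∀ k, 0 < b k ∧ b k < 1) (k : Fin m) (u : Bool) :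
    0 < bitProb b k u := by
  cases u
  · simpa [bitProb] using (hb k).1
  · simpa [bitProb] using (hb k).2

theorem sum_bitProb (b : Fin m → ℝ) (k : Fin m) : ∑ u, bitProb b k u = 1 := by
  simp [bitProb]

theorem symbolProb_pos {b : Fin m → ℝ} (hb : ∀ k, 0 < b k ∧ b k < 1) (i : Fin (2 ^ m)) :
    0 < symbolProb b i :=
  Finset.prod_pos fun k _ => bitProb_pos hb k _

theorem sum_symbolProb_mul_prod (b : Fin m → ℝ) (G : Fin m → Bool → ℝ) :
    ∑ i, symbolProb b i * ∏ k, G k (nbc i k) = ∏ k, ∑ u, bitProb b k u * G k u := by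
  rw [← sum_prod_nbc]
  simp only [symbolProb, Finset.prod_mul_distrib]

theorem sum_symbolProb (b : Fin m → ℝ) : ∑ i, symbolProb b i = 1 := by
  have h := sum_symbolProb_mul_prod b fun _ _ => 1
  simpa only [Finset.prod_const_one, mul_one, sum_bitProb] using h

theorem sum_symbolProb_mul (b : Fin m → ℝ) (k : Fin m) (g : Bool → ℝ) :
    ∑ i, symbolProb b i * g (nbc i k) = ∑ u, bitProb b k u * g u := by
  have h := sum_symbolProb_mul_prod b fun l u => if l = k then g u else 1
  simp only [Finset.prod_ite_eq', Finset.mem_univ, if_true] at h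
  rw [h, Finset.prod_eq_single k]
  · simp
  · intro l _ hl
    simp only [hl, if_false, mul_one, sum_bitProb]
  · simp

theorem sum_symbolProb_mul_mul (b : Fin m → ℝ) {k l : Fin m} (hkl : k ≠ l) (g g' : Bool → ℝ) :
    ∑ i, symbolProb b i * (g (nbc i k) * g' (nbc i l))
      = (∑ u, bitProb b k u * g u) * ∑ u, bitProb b l u * g' u := by
  have h := sum_symbolProb_mul_prod b fun j u =>
    (if j = k then g u else 1) * if j = l then g' u else 1
  simp only [Finset.prod_mul_distrib, Finset.prod_ite_eq', Finset.mem_univ, if_true] at h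
  rw [h]
  have e : ∀ j, ∑ u, bitProb b j u * ((if j = k then g u else 1) * if j = l then g' u else 1)
      = (if j = k then ∑ u, bitProb b j u * g u else 1) *
        if j = l then ∑ u, bitProb b j u * g' u else 1 := by
    intro j
    by_cases h1 : j = k
    · have h2 : j ≠ l := fun h3 => hkl (h1.symm.trans h3)
      simp only [h1, hkl, if_true, if_false, mul_one]
    · by_cases h2 : j = l
      · simp only [h2, hkl.symm, if_true, if_false, one_mul]
      · simp only [h1, h2, if_false, mul_one, sum_bitProb]
  simp only [e, Finset.prod_mul_distrib, Finset.prod_ite_eq', Finset.mem_univ, if_true]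

/-- The conditional law of the symbol index given that its `k`th bit is `u`. -/
def condProb (b : Fin m → ℝ) (k : Fin m) (u : Bool) (i : Fin (2 ^ m)) : ℝ :=
  if nbc i k = u then symbolProb b i / bitProb b k u else 0

theorem symbolProb_mem_stdSimplex {b : Fin m → ℝ} (hb : ∀ k, 0 < b k ∧ b k < 1) :
    symbolProb b ∈ stdSimplex ℝ (Fin (2 ^ m)) :=
  ⟨fun i => (symbolProb_pos hb i).le, sum_symbolProb b⟩

theorem bitProb_mul_condProb {b : Fin m → ℝ} (hb : ∀ k, 0 < b k ∧ b k < 1) (k : Fin m) (u : Bool)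
    (i : Fin (2 ^ m)) :
    bitProb b k u * condProb b k u i = symbolProb b i * if nbc i k = u then 1 else 0 := by
  have := (bitProb_pos hb k u).ne'
  unfold condProb
  split_ifs
  · field_simp
  · simp

theorem condProb_mem_stdSimplex {b : Fin m → ℝ} (hb : ∀ k, 0 < b k ∧ b k < 1) (k : Fin m)
    (u : Bool) : condProb b k u ∈ stdSimplex ℝ (Fin (2 ^ m)) := by
  refine ⟨fun i => ?_, ?_⟩
  · unfold condProb
    split_ifs
    · exact (div_pos (symbolProb_pos hb i) (bitProb_pos hb k u)).le
    · exact le_rfl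
  · refine mul_left_cancel₀ (bitProb_pos hb k u).ne' ?_
    rw [Finset.mul_sum]
    simp only [bitProb_mul_condProb hb]
    rw [sum_symbolProb_mul b k fun v => if v = u then 1 else 0]
    simp

theorem sum_bitProb_mul_condProb {b : Fin m → ℝ} (hb : ∀ k, 0 < b k ∧ b k < 1) (k : Fin m)
    (i : Fin (2 ^ m)) : ∑ u, bitProb b k u * condProb b k u i = symbolProb b i := by
  simp [bitProb_mul_condProb hb]

/-- The mean of the symbol given that its `k`th bit is `u`. -/
def condMean (b : Fin m → ℝ) (X : Fin (2 ^ m) → EuclideanSpace ℝ (Fin N)) (k : Fin m) (u : Bool) :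
    EuclideanSpace ℝ (Fin N) :=
  ∑ i, condProb b k u i • X i

/-- The mean of the symbol. -/
def symbolMean (b : Fin m → ℝ) (X : Fin (2 ^ m) → EuclideanSpace ℝ (Fin N)) :
    EuclideanSpace ℝ (Fin N) :=
  ∑ i, symbolProb b i • X i

theorem sum_bitProb_smul_condMean {b : Fin m → ℝ} (hb : ∀ k, 0 < b k ∧ b k < 1)
    (X : Fin (2 ^ m) → EuclideanSpace ℝ (Fin N)) (k : Fin m) :
    ∑ u, bitProb b k u • condMean b X k u = symbolMean b X := by
  simp only [condMean, Finset.smul_sum, smul_smul]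
  rw [Finset.sum_comm]
  simp only [← Finset.sum_smul, sum_bitProb_mul_condProb hb, symbolMean]

/-- Conditioning on bit k: against a function of that bit, the symbol may be replaced by its
conditional mean. -/
theorem sum_symbolProb_mul_inner {b : Fin m → ℝ} (hb : ∀ k, 0 < b k ∧ b k < 1)
    (X : Fin (2 ^ m) → EuclideanSpace ℝ (Fin N)) (k : Fin m)
    (g : Bool → EuclideanSpace ℝ (Fin N)) :
    ∑ i, symbolProb b i * inner ℝ (X i) (g (nbc i k))
      = ∑ u, bitProb b k u * inner ℝ (condMean b X k u) (g u) := by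
  simp only [condMean, sum_inner, inner_smul_left, Finset.mul_sum, ← mul_assoc]
  rw [Finset.sum_comm]
  refine Finset.sum_congr rfl fun i _ => ?_
  simp only [RCLike.conj_to_real, bitProb_mul_condProb hb]
  simp

/-- Independence factors the expectation coordinatewise, and the centred factor has mean zero. -/
theorem sum_symbolProb_mul_inner_eq_zero (b : Fin m → ℝ) {k l : Fin m} (hkl : k ≠ l)
    (g g' : Bool → EuclideanSpace ℝ (Fin N)) (hg : ∑ u, bitProb b k u • g u = 0) :
    ∑ i, symbolProb b i * inner ℝ (g (nbc i k)) (g' (nbc i l)) = 0 := by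
  simp only [PiLp.inner_apply, Finset.mul_sum]
  rw [Finset.sum_comm]
  refine Finset.sum_eq_zero fun n _ => ?_
  have h := sum_symbolProb_mul_mul b hkl (fun u => g u n) (fun u => g' u n)
  have h0 : ∑ u, bitProb b k u * g u n = 0 := by
    have := congrArg (fun v : EuclideanSpace ℝ (Fin N) => v n) hg
    simpa using this
  rw [h0, zero_mul] at h
  rw [← h]
  refine Finset.sum_congr rfl fun i _ => ?_
  simp [mul_comm]

/-- The sum of the variances of the conditional means of the symbol given each of its bits. -/
def bitwiseVariance (b : Fin m → ℝ) (X : Fin (2 ^ m) → EuclideanSpace ℝ (Fin N)) : ℝ :=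
  ∑ k, ∑ u, bitProb b k u * ‖condMean b X k u - symbolMean b X‖ ^ 2

theorem sum_bitProb_mul_inner_sub {b : Fin m → ℝ} {k : Fin m}
    {g : Bool → EuclideanSpace ℝ (Fin N)} (hg : ∑ u, bitProb b k u • g u = 0)
    (c : Bool → EuclideanSpace ℝ (Fin N)) (μ : EuclideanSpace ℝ (Fin N)) :
    ∑ u, bitProb b k u * inner ℝ (c u - μ) (g u) = ∑ u, bitProb b k u * inner ℝ (c u) (g u) := by
  have h : ∑ u, bitProb b k u * inner ℝ μ (g u) = 0 := by
    simp only [← inner_smul_right]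
    rw [← inner_sum, hg, inner_zero_right]
  simp only [inner_sub_left, mul_sub, Finset.sum_sub_distrib, h, sub_zero]

theorem sum_bitProb_smul_condMean_sub {b : Fin m → ℝ} (hb : ∀ k, 0 < b k ∧ b k < 1)
    (X : Fin (2 ^ m) → EuclideanSpace ℝ (Fin N)) (k : Fin m) :
    ∑ u, bitProb b k u • (condMean b X k u - symbolMean b X) = 0 := by
  simp only [smul_sub, Finset.sum_sub_distrib]
  rw [sum_bitProb_smul_condMean hb, ← Finset.sum_smul, sum_bitProb, one_smul, sub_self]

/-- Variance as second moment minus squared mean, the form in which the relative entropy limits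
produce it. -/
theorem bitwiseVariance_eq {b : Fin m → ℝ} (hb : ∀ k, 0 < b k ∧ b k < 1)
    (X : Fin (2 ^ m) → EuclideanSpace ℝ (Fin N)) :
    bitwiseVariance b X
      = ∑ k, (∑ u, bitProb b k u * ‖condMean b X k u‖ ^ 2 - ‖symbolMean b X‖ ^ 2) := by
  refine Finset.sum_congr rfl fun k _ => ?_
  have h := sum_bitProb_mul_inner_sub (sum_bitProb_smul_condMean_sub hb X k)
    (condMean b X k) (symbolMean b X)
  simp only [real_inner_self_eq_norm_sq] at h
  rw [h]
  simp only [inner_sub_right, real_inner_self_eq_norm_sq, mul_sub, Finset.sum_sub_distrib]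
  congr 1
  simp only [← real_inner_smul_left]
  rw [← sum_inner, sum_bitProb_smul_condMean hb, real_inner_self_eq_norm_sq]

/-- Mean square error of the approximation of the symbol by a sum of centred functions of its
bits. -/
theorem sum_symbolProb_mul_norm_sub_sq {b : Fin m → ℝ} (hb : ∀ k, 0 < b k ∧ b k < 1)
    (X : Fin (2 ^ m) → EuclideanSpace ℝ (Fin N)) (f : Fin m → Bool → EuclideanSpace ℝ (Fin N))
    (hf : ∀ k, ∑ u, bitProb b k u • f k u = 0) :
    ∑ i, symbolProb b i * ‖X i - ∑ k, f k (nbc i k)‖ ^ 2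
      = symbolEnergy b X - bitwiseVariance b X
        + ∑ k, ∑ u, bitProb b k u * ‖condMean b X k u - symbolMean b X - f k u‖ ^ 2 := by
  have h1 : ∑ i, symbolProb b i * inner ℝ (X i) (∑ k, f k (nbc i k))
      = ∑ k, ∑ u, bitProb b k u * inner ℝ (condMean b X k u - symbolMean b X) (f k u) := by
    simp only [inner_sum, Finset.mul_sum]
    rw [Finset.sum_comm]
    refine Finset.sum_congr rfl fun k _ => ?_
    rw [sum_symbolProb_mul_inner hb, sum_bitProb_mul_inner_sub (hf k)]
  have h2 : ∑ i, symbolProb b i * ‖∑ k, f k (nbc i k)‖ ^ 2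
      = ∑ k, ∑ u, bitProb b k u * ‖f k u‖ ^ 2 := by
    simp only [← real_inner_self_eq_norm_sq, sum_inner, inner_sum, Finset.mul_sum]
    rw [Finset.sum_comm]
    refine Finset.sum_congr rfl fun k _ => ?_
    rw [Finset.sum_comm, Finset.sum_eq_single k]
    · exact sum_symbolProb_mul b k fun u => inner ℝ (f k u) (f k u)
    · intro l _ hl
      exact sum_symbolProb_mul_inner_eq_zero b hl (f l) (f k) (hf l)
    · simp
  simp only [norm_sub_sq_real, mul_add, mul_sub, Finset.sum_add_distrib, Finset.sum_sub_distrib,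
    h2, symbolEnergy, bitwiseVariance]
  have e1 : ∑ i, symbolProb b i * (2 * inner ℝ (X i) (∑ k, f k (nbc i k)))
      = 2 * ∑ i, symbolProb b i * inner ℝ (X i) (∑ k, f k (nbc i k)) := by
    rw [Finset.mul_sum]
    exact Finset.sum_congr rfl fun i _ => by ring
  have e2 : ∑ k, ∑ u, bitProb b k u *
        (2 * inner ℝ (condMean b X k u - symbolMean b X) (f k u))
      = 2 * ∑ k, ∑ u, bitProb b k u * inner ℝ (condMean b X k u - symbolMean b X) (f k u) := by
    simp only [Finset.mul_sum]
    exact Finset.sum_congr rfl fun k _ => Finset.sum_congr rfl fun u _ => by ring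
  rw [e1, e2, h1]
  ring

/-- Taking f to be the centred conditional means shows that energy minus variance is a mean square
error. For an exact representation the error is 0 yet equals a sum of two nonnegative terms, so both
vanish; the converse uses that every symbol has positive probability. -/
theorem bitwiseVariance_eq_symbolEnergy_iff {b : Fin m → ℝ} (hb : ∀ k, 0 < b k ∧ b k < 1)
    (X : Fin (2 ^ m) → EuclideanSpace ℝ (Fin N)) :
    bitwiseVariance b X = symbolEnergy b X ↔
      ∃ f : Fin m → Bool → EuclideanSpace ℝ (Fin N), (∀ k, ∑ u, bitProb b k u • f k u = 0) ∧
        ∀ i, X i = ∑ k, f k (nbc i k) := by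
  have hd := sum_symbolProb_mul_norm_sub_sq hb X _ (sum_bitProb_smul_condMean_sub hb X)
  simp only [sub_self, norm_zero, ne_eq, OfNat.ofNat_ne_zero, not_false_eq_true, zero_pow,
    mul_zero, Finset.sum_const_zero, add_zero] at hd
  have hnn : ∀ g : Fin (2 ^ m) → EuclideanSpace ℝ (Fin N), ∀ i ∈ Finset.univ,
      0 ≤ symbolProb b i * ‖g i‖ ^ 2 :=
    fun g i _ => mul_nonneg (symbolProb_pos hb i).le (sq_nonneg _)
  constructor
  · intro h
    refine ⟨_, sum_bitProb_smul_condMean_sub hb X, fun i => ?_⟩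
    rw [h, sub_self] at hd
    have h1 := (Finset.sum_eq_zero_iff_of_nonneg (hnn _)).1 hd i (Finset.mem_univ i)
    simpa [(symbolProb_pos hb i).ne', sub_eq_zero] using h1
  · rintro ⟨f, hf, hX⟩
    have h := sum_symbolProb_mul_norm_sub_sq hb X f hf
    have h1 : 0 ≤ symbolEnergy b X - bitwiseVariance b X := by
      rw [← hd]
      exact Finset.sum_nonneg (hnn _)
    have h2 : 0 ≤ ∑ k, ∑ u, bitProb b k u * ‖condMean b X k u - symbolMean b X - f k u‖ ^ 2 :=
      Finset.sum_nonneg fun k _ => Finset.sum_nonneg fun u _ =>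
        mul_nonneg (bitProb_pos hb k u).le (sq_nonneg _)
    simp only [← hX, sub_self, norm_zero, ne_eq, OfNat.ofNat_ne_zero, not_false_eq_true, zero_pow,
      mul_zero, Finset.sum_const_zero] at h
    linarith

theorem symbolEnergy_pos {b : Fin m → ℝ} (hb : ∀ k, 0 < b k ∧ b k < 1)
    {X : Fin (2 ^ m) → EuclideanSpace ℝ (Fin N)} (hX : X ≠ 0) : 0 < symbolEnergy b X := by
  obtain ⟨i, hi⟩ := Function.ne_iff.1 hX
  refine Finset.sum_pos' (fun j _ => mul_nonneg (symbolProb_pos hb j).le (sq_nonneg _))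
    ⟨i, Finset.mem_univ i, mul_pos (symbolProb_pos hb i) ?_⟩
  have : 0 < ‖X i‖ := norm_pos_iff.2 hi
  positivity

end Energy

end BICM

namespace BICM

open Filter Topology Real

/-! ### The channel densities as Gaussian mixtures -/

section Channel

variable {m N : ℕ}

theorem channelPdf_eq (N₀ : ℝ) (h x y : EuclideanSpace ℝ (Fin N)) :
    channelPdf N₀ h x y = gaussDensity N₀ y * likelihood N₀ (ewProd h x) y := by
  rw [gaussDensity_mul_likelihood]
  simp [channelPdf, gaussDensity]

theorem outputPdf_eq (N₀ : ℝ) (b : Fin m → ℝ) (X : Fin (2 ^ m) → EuclideanSpace ℝ (Fin N))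
    (h y : EuclideanSpace ℝ (Fin N)) :
    outputPdf N₀ b X h y
      = gaussDensity N₀ y * mixtureLikelihood N₀ (symbolProb b) (fun i => ewProd h (X i)) y := by
  simp only [outputPdf, channelPdf_eq, mixtureLikelihood, Finset.mul_sum]
  exact Finset.sum_congr rfl fun i _ => by ring

theorem bitOutputPdf_eq (N₀ : ℝ) (b : Fin m → ℝ) (X : Fin (2 ^ m) → EuclideanSpace ℝ (Fin N))
    (k : Fin m) (u : Bool) (h y : EuclideanSpace ℝ (Fin N)) :
    bitOutputPdf N₀ b X k u h y
      = gaussDensity N₀ y * mixtureLikelihood N₀ (condProb b k u) (fun i => ewProd h (X i)) y := by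
  simp only [bitOutputPdf, channelPdf_eq, mixtureLikelihood, Finset.mul_sum, Finset.sum_filter,
    condProb]
  refine Finset.sum_congr rfl fun i _ => ?_
  split_ifs
  · ring
  · ring

theorem bitMutualInfoAt_eq {N₀ : ℝ} (hN₀ : 0 < N₀) {b : Fin m → ℝ} (hb : ∀ k, 0 < b k ∧ b k < 1)
    (X : Fin (2 ^ m) → EuclideanSpace ℝ (Fin N)) (k : Fin m) (h : EuclideanSpace ℝ (Fin N)) :
    bitMutualInfoAt N₀ b X k h
      = (∑ u, bitProb b k u * mixtureKL N₀ (condProb b k u) (fun i => ewProd h (X i))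
          - mixtureKL N₀ (symbolProb b) fun i => ewProd h (X i)) / log 2 := by
  rw [← sum_integral_mixtureLikelihood_mul_log_div hN₀ (fun u => bitProb_pos hb k u)
    (fun u => condProb_mem_stdSimplex hb k u) (symbolProb_mem_stdSimplex hb)
    (fun i => sum_bitProb_mul_condProb hb k i), Finset.sum_div]
  refine Finset.sum_congr rfl fun u _ => ?_
  rw [mul_div_assoc, ← integral_div]
  congr 2
  funext y
  rw [bitOutputPdf_eq, outputPdf_eq, mul_div_mul_left _ _ (gaussDensity_pos hN₀ y).ne',
    Real.logb, mul_div_assoc]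

theorem ewProd_smul (t : ℝ) (h x : EuclideanSpace ℝ (Fin N)) :
    ewProd h (t • x) = t • ewProd h x := by
  ext n
  simp [ewProd]
  ring

theorem ewProd_sum_smul (h : EuclideanSpace ℝ (Fin N)) {ι : Type*} [Fintype ι] (w : ι → ℝ)
    (x : ι → EuclideanSpace ℝ (Fin N)) :
    ewProd h (∑ i, w i • x i) = ∑ i, w i • ewProd h (x i) := by
  ext n
  simp only [ewProd, WithLp.ofLp_sum, WithLp.ofLp_smul, Finset.sum_apply, Pi.smul_apply,
    smul_eq_mul, Finset.mul_sum]
  exact Finset.sum_congr rfl fun i _ => by ring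

@[fun_prop]
theorem continuous_ewProd (x : EuclideanSpace ℝ (Fin N)) : Continuous fun h => ewProd h x := by
  unfold ewProd
  fun_prop

theorem norm_ewProd_sq (h x : EuclideanSpace ℝ (Fin N)) :
    ‖ewProd h x‖ ^ 2 = ∑ n, h n ^ 2 * x n ^ 2 := by
  simp [EuclideanSpace.norm_sq_eq, ewProd, mul_pow]

end Channel

/-! ### Averaging over the fading and the slope at zero -/

section Fading

variable {m N : ℕ} {ρ : Measure (EuclideanSpace ℝ (Fin N))} {ν : Measure ℝ}

theorem integrable_coord_sq (hν : ∀ n, ρ.map (fun h => h n) = ν)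
    (hint : Integrable (fun t : ℝ => t ^ 2) ν) (n : Fin N) :
    Integrable (fun h : EuclideanSpace ℝ (Fin N) => h n ^ 2) ρ := by
  rw [← hν n] at hint
  exact hint.comp_measurable (by fun_prop)

theorem integral_coord_sq (hν : ∀ n, ρ.map (fun h => h n) = ν) (n : Fin N) :
    ∫ h, h n ^ 2 ∂ρ = ∫ t, t ^ 2 ∂ν := by
  rw [← hν n, integral_map (by fun_prop) (by fun_prop)]

theorem integrable_norm_ewProd_sq (hν : ∀ n, ρ.map (fun h => h n) = ν)
    (hint : Integrable (fun t : ℝ => t ^ 2) ν) (x : EuclideanSpace ℝ (Fin N)) :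
    Integrable (fun h => ‖ewProd h x‖ ^ 2) ρ := by
  simp only [norm_ewProd_sq]
  exact integrable_finsetSum _ fun n _ => (integrable_coord_sq hν hint n).mul_const _

/-- The squared norm has no cross terms between coordinates, so only the common marginal matters and
dependence between components is harmless. -/
theorem integral_norm_ewProd_sq (hν : ∀ n, ρ.map (fun h => h n) = ν)
    (hint : Integrable (fun t : ℝ => t ^ 2) ν) (x : EuclideanSpace ℝ (Fin N)) :
    ∫ h, ‖ewProd h x‖ ^ 2 ∂ρ = (∫ t, t ^ 2 ∂ν) * ‖x‖ ^ 2 := by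
  simp only [norm_ewProd_sq]
  rw [integral_finsetSum _ fun n _ => (integrable_coord_sq hν hint n).mul_const _]
  simp only [integral_mul_const, integral_coord_sq hν, ← Finset.mul_sum]
  simp [EuclideanSpace.norm_sq_eq]

theorem stronglyMeasurable_mixtureKL_ewProd {ι : Type*} [Fintype ι] (c : ℝ) (w : ι → ℝ)
    (x : ι → EuclideanSpace ℝ (Fin N)) :
    StronglyMeasurable fun h : EuclideanSpace ℝ (Fin N) =>
      mixtureKL c w fun i => ewProd h (x i) := by
  have hcont : Continuous fun p : EuclideanSpace ℝ (Fin N) × EuclideanSpace ℝ (Fin N) =>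
      gaussDensity c p.2 *
        InformationTheory.klFun (mixtureLikelihood c w (fun i => ewProd p.1 (x i)) p.2) := by
    unfold mixtureLikelihood likelihood
    fun_prop
  exact hcont.stronglyMeasurable.integral_prod_right'

/-- Average over the fading of the relative entropy of a mixture, to second order. -/
theorem tendsto_integral_mixtureKL_smul_div_sq {ι : Type*} [Fintype ι] {c : ℝ} (hc : 0 < c)
    {w : ι → ℝ} (hw : w ∈ stdSimplex ℝ ι) (x : ι → EuclideanSpace ℝ (Fin N))
    (hν : ∀ n, ρ.map (fun h => h n) = ν) (hint : Integrable (fun t : ℝ => t ^ 2) ν) :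
    Tendsto (fun t : ℝ => (∫ h, mixtureKL c w (fun i => ewProd h (t • x i)) ∂ρ) / t ^ 2) (𝓝[≠] 0)
      (𝓝 ((∫ t, t ^ 2 ∂ν) * ‖∑ i, w i • x i‖ ^ 2 / c)) := by
  rw [← integral_norm_ewProd_sq hν hint, ← integral_div]
  simp only [← integral_div]
  -- The bound of `mixtureKL_le` divided by t² is independent of t and integrable in h by the second
  -- moment assumption.
  refine tendsto_integral_filter_of_dominated_convergence
    (fun h => ∑ i, w i * (‖ewProd h (x i)‖ ^ 2 / c)) ?_ ?_ ?_ ?_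
  · refine Eventually.of_forall fun t => ?_
    exact ((stronglyMeasurable_mixtureKL_ewProd c w fun i => t • x i).measurable.div_const
      _).aestronglyMeasurable
  · filter_upwards [self_mem_nhdsWithin] with t ht
    have ht : t ≠ 0 := ht
    have ht2 : 0 < t ^ 2 := by positivity
    refine Eventually.of_forall fun h => ?_
    rw [Real.norm_of_nonneg (div_nonneg (mixtureKL_nonneg hc hw _) ht2.le), div_le_iff₀ ht2]
    refine (mixtureKL_le hc hw _).trans_eq ?_
    rw [Finset.sum_mul]
    refine Finset.sum_congr rfl fun i _ => ?_
    rw [ewProd_smul, norm_smul, mul_pow, Real.norm_eq_abs, sq_abs]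
    ring
  · exact integrable_finsetSum _ fun i _ =>
      ((integrable_norm_ewProd_sq hν hint (x i)).div_const c).const_mul (w i)
  · refine Eventually.of_forall fun h => ?_
    rw [ewProd_sum_smul]
    simp only [ewProd_smul]
    exact tendsto_mixtureKL_smul_div_sq hc hw fun i => ewProd h (x i)

theorem integrable_mixtureKL_ewProd {ι : Type*} [Fintype ι] {c : ℝ} (hc : 0 < c)
    {w : ι → ℝ} (hw : w ∈ stdSimplex ℝ ι) (x : ι → EuclideanSpace ℝ (Fin N))
    (hν : ∀ n, ρ.map (fun h => h n) = ν) (hint : Integrable (fun t : ℝ => t ^ 2) ν) :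
    Integrable (fun h => mixtureKL c w fun i => ewProd h (x i)) ρ := by
  refine (integrable_finsetSum Finset.univ fun i _ =>
    ((integrable_norm_ewProd_sq hν hint (x i)).div_const c).const_mul (w i)).mono'
    (stronglyMeasurable_mixtureKL_ewProd c w x).aestronglyMeasurable
    (Eventually.of_forall fun h => ?_)
  rw [Real.norm_of_nonneg (mixtureKL_nonneg hc hw _)]
  exact mixtureKL_le hc hw _

theorem bitMutualInfo_eq {N₀ : ℝ} (hN₀ : 0 < N₀) {b : Fin m → ℝ} (hb : ∀ k, 0 < b k ∧ b k < 1)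
    (X : Fin (2 ^ m) → EuclideanSpace ℝ (Fin N)) (k : Fin m)
    (hν : ∀ n, ρ.map (fun h => h n) = ν) (hint : Integrable (fun t : ℝ => t ^ 2) ν) :
    bitMutualInfo ρ N₀ b X k
      = (∑ u, bitProb b k u * ∫ h, mixtureKL N₀ (condProb b k u) (fun i => ewProd h (X i)) ∂ρ
          - ∫ h, mixtureKL N₀ (symbolProb b) (fun i => ewProd h (X i)) ∂ρ) / log 2 := by
  have h1 := fun u => (integrable_mixtureKL_ewProd (ρ := ρ) hN₀ (condProb_mem_stdSimplex hb k u) X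
    hν hint).const_mul (bitProb b k u)
  have h2 := integrable_mixtureKL_ewProd (ρ := ρ) hN₀ (symbolProb_mem_stdSimplex hb) X hν hint
  simp only [bitMutualInfo, bitMutualInfoAt_eq hN₀ hb]
  rw [integral_div, integral_sub (integrable_finsetSum _ fun u _ => h1 u) h2,
    integral_finsetSum _ fun u _ => h1 u]
  simp only [integral_const_mul]

theorem tendsto_gmi_smul_div_sq {N₀ : ℝ} (hN₀ : 0 < N₀) {b : Fin m → ℝ}
    (hb : ∀ k, 0 < b k ∧ b k < 1) (X : Fin (2 ^ m) → EuclideanSpace ℝ (Fin N))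
    (hν : ∀ n, ρ.map (fun h => h n) = ν) (hint : Integrable (fun t : ℝ => t ^ 2) ν) :
    Tendsto (fun t : ℝ => gmi ρ N₀ b (fun i => t • X i) / t ^ 2) (𝓝[≠] 0)
      (𝓝 ((∫ t, t ^ 2 ∂ν) * (bitwiseVariance b X / N₀) / log 2)) := by
  have hk : ∀ k, Tendsto (fun t : ℝ => bitMutualInfo ρ N₀ b (fun i => t • X i) k / t ^ 2) (𝓝[≠] 0)
      (𝓝 ((∑ u, bitProb b k u * ((∫ t, t ^ 2 ∂ν) * ‖condMean b X k u‖ ^ 2 / N₀)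
        - (∫ t, t ^ 2 ∂ν) * ‖symbolMean b X‖ ^ 2 / N₀) / log 2)) := by
    intro k
    have h1 := tendsto_finsetSum Finset.univ fun u _ =>
      (tendsto_integral_mixtureKL_smul_div_sq (ρ := ρ) hN₀ (condProb_mem_stdSimplex hb k u) X
        hν hint).const_mul (bitProb b k u)
    have h2 := tendsto_integral_mixtureKL_smul_div_sq (ρ := ρ) hN₀ (symbolProb_mem_stdSimplex hb) X
      hν hint
    refine ((h1.sub h2).div_const (log 2)).congr fun t => ?_
    rw [bitMutualInfo_eq hN₀ hb _ k hν hint]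
    simp only [← mul_div_assoc]
    rw [← Finset.sum_div]
    ring
  have h := tendsto_finsetSum Finset.univ fun k _ => hk k
  simp only [← Finset.sum_div] at h
  convert! h using 2
  rw [bitwiseVariance_eq hb]
  congr 1
  rw [Finset.sum_div, Finset.mul_sum]
  refine Finset.sum_congr rfl fun k _ => ?_
  rw [sub_div, mul_sub, Finset.sum_div, Finset.mul_sum, mul_div_assoc]
  congr 1
  exact Finset.sum_congr rfl fun u _ => by ring

theorem gmi_zero {N₀ : ℝ} (hN₀ : 0 < N₀) {b : Fin m → ℝ} (hb : ∀ k, 0 < b k ∧ b k < 1) :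
    gmi ρ N₀ b (0 : Fin (2 ^ m) → EuclideanSpace ℝ (Fin N)) = 0 := by
  have h0 : ∀ h : EuclideanSpace ℝ (Fin N), ewProd h 0 = 0 := fun h => by
    simpa using ewProd_smul 0 h 0
  have h1 : ∀ {w : Fin (2 ^ m) → ℝ}, w ∈ stdSimplex ℝ (Fin (2 ^ m)) →
      mixtureKL N₀ w (fun _ => (0 : EuclideanSpace ℝ (Fin N))) = 0 := fun hw =>
    le_antisymm (by simpa using mixtureKL_le hN₀ hw fun _ => (0 : EuclideanSpace ℝ (Fin N)))
      (mixtureKL_nonneg hN₀ hw _)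
  have h2 : ∀ k u, mixtureKL N₀ (condProb b k u)
      (fun _ => (0 : EuclideanSpace ℝ (Fin N))) = 0 :=
    fun k u => h1 (condProb_mem_stdSimplex hb k u)
  simp [gmi, bitMutualInfo, bitMutualInfoAt_eq hN₀ hb, h0, h1 (symbolProb_mem_stdSimplex hb), h2]

/-- The slope at zero of the mutual information as a function of the signal-to-noise ratio. -/
theorem hasDerivWithinAt_gmiOfSNR {N₀ : ℝ} (hN₀ : 0 < N₀) {b : Fin m → ℝ}
    (hb : ∀ k, 0 < b k ∧ b k < 1) {X : Fin (2 ^ m) → EuclideanSpace ℝ (Fin N)} (hX : X ≠ 0)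
    (hν : ∀ n, ρ.map (fun h => h n) = ν) (hint : Integrable (fun t : ℝ => t ^ 2) ν)
    (hpos : 0 < ∫ t, t ^ 2 ∂ν) :
    HasDerivWithinAt (gmiOfSNR ρ ν N₀ b X)
      (bitwiseVariance b X / symbolEnergy b X * logb 2 (exp 1)) (Set.Ici 0) 0 := by
  have hE := symbolEnergy_pos hb hX
  have hsnr : 0 < snr ν N₀ b X := mul_pos hpos (div_pos hE hN₀)
  rw [hasDerivWithinAt_iff_tendsto_slope, Set.Ici_sdiff_left]
  -- SNR is quadratic in amplitude: the substitution t = √(s/snr) turns the limit of gmi/t² into the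
  -- right slope in s.
  have hsqrt : Tendsto (fun s : ℝ => √(s / snr ν N₀ b X)) (𝓝[>] 0) (𝓝[≠] 0) := by
    refine tendsto_nhdsWithin_iff.2 ⟨?_, ?_⟩
    · have h : Continuous fun s : ℝ => √(s / snr ν N₀ b X) := by fun_prop
      have h0 := h.tendsto 0
      simp only [zero_div, sqrt_zero] at h0
      exact h0.mono_left nhdsWithin_le_nhds
    · filter_upwards [self_mem_nhdsWithin] with s hs
      exact (sqrt_pos.2 (div_pos hs hsnr)).ne'
  have h := ((tendsto_gmi_smul_div_sq (ρ := ρ) hN₀ hb X hν hint).comp hsqrt).div_const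
    (snr ν N₀ b X)
  have e : (∫ t, t ^ 2 ∂ν) * (bitwiseVariance b X / N₀) / log 2 / snr ν N₀ b X
      = bitwiseVariance b X / symbolEnergy b X * logb 2 (exp 1) := by
    rw [logb, log_exp, snr]
    field_simp
  rw [e] at h
  refine h.congr' ?_
  filter_upwards [self_mem_nhdsWithin] with s hs
  have hs : 0 < s := hs
  have h0 : gmiOfSNR ρ ν N₀ b X 0 = 0 := by
    have : rescaled ν N₀ b X 0 = 0 := by
      funext i
      simp [rescaled]
    rw [gmiOfSNR, this, gmi_zero hN₀ hb]
  rw [slope_def_field, h0, sub_zero, sub_zero, Function.comp_apply,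
    sq_sqrt (div_pos hs hsnr).le, div_div, div_mul_cancel₀ _ hsnr.ne']
  rfl

/-- One-sided derivatives on [0, ∞) are unique at 0, so first-order optimality says that the ratio
of variance to energy is 1. -/
theorem isFOO_iff_bitwiseVariance_eq {N₀ : ℝ} (hN₀ : 0 < N₀) {b : Fin m → ℝ}
    (hb : ∀ k, 0 < b k ∧ b k < 1) {X : Fin (2 ^ m) → EuclideanSpace ℝ (Fin N)} (hX : X ≠ 0)
    (hν : ∀ n, ρ.map (fun h => h n) = ν) (hint : Integrable (fun t : ℝ => t ^ 2) ν)
    (hpos : 0 < ∫ t, t ^ 2 ∂ν) :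
    IsFOO ρ ν N₀ b X ↔ bitwiseVariance b X = symbolEnergy b X := by
  have hE := symbolEnergy_pos hb hX
  have hd := hasDerivWithinAt_gmiOfSNR (ρ := ρ) hN₀ hb hX hν hint hpos
  have hl : logb 2 (exp 1) ≠ 0 := by
    rw [logb, log_exp]
    have := log_pos one_lt_two
    positivity
  constructor
  · intro h
    have h1 := (uniqueDiffWithinAt_Ici (0 : ℝ)).eq_deriv _ hd h
    have h2 := mul_right_cancel₀ hl (h1.trans (one_mul _).symm)
    rwa [div_eq_one_iff_eq hE.ne'] at h2
  · intro h
    rw [h, div_self hE.ne', one_mul] at hd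
    exact hd

end Fading

end BICM

end

theorem theorem7 {m N : ℕ} (b : Fin m → ℝ) (hb : ∀ k, 0 < b k ∧ b k < 1)
    (X : Fin (2 ^ m) → EuclideanSpace ℝ (Fin N)) (hX : X ≠ 0)
    (N₀ : ℝ) (hN₀ : 0 < N₀)
    (ρ : Measure (EuclideanSpace ℝ (Fin N))) [IsProbabilityMeasure ρ]
    (ν : Measure ℝ) (hν : ∀ n, ρ.map (fun h => h n) = ν)
    (hint : Integrable (fun t : ℝ => t ^ 2) ν) (hpos : 0 < ∫ t, t ^ 2 ∂ν) :
    BICM.IsFOO ρ ν N₀ b X ↔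
      (BICM.hadamard X (BICM.zeroIdx m) =
          ∑ k, (BICM.bitProb b k true - BICM.bitProb b k false) •
            BICM.hadamard X (BICM.powTwo k)) ∧
        ∀ j : Fin (2 ^ m), j ≠ BICM.zeroIdx m → (∀ k : Fin m, j ≠ BICM.powTwo k) →
          BICM.hadamard X j = 0 := by
  rw [BICM.isFOO_iff_bitwiseVariance_eq hN₀ hb hX hν hint hpos,
    BICM.bitwiseVariance_eq_symbolEnergy_iff hb, BICM.exists_centred_iff_hadamard]
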